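/- Let $F_n$ be the free group on $A=\{a_1,\dots,a_n\}$, $n\ge 0$, and let $A^{\pm}=A\sqcup A^{-1}$. For subgroups $H,K\leqslant F_n$ write $H\oplus K=F_n$ if $\langle H\cup K\rangle=F_n$ and $H\cap K=\{1\}$. For a subgroup $H$ of $F_n$ let $$\mathrm{Coc}_{\oplus}(H)=\{u\in F_n : H\oplus\langle u\rangle=F_n\}$$ be its set of direct cocycles. If $H$ is finitely generated, then $\mathrm{Coc}_{\oplus}(H)$ is a context-free subset of $F_n$, i.e. the set of reduced words over $A^{\pm}$ that represent the elements of $\mathrm{Coc}_{\oplus}(H)$ is a context-free language over $A^{\pm}$. Moreover, there is an algorithm that, given $n$ and a finite list of words over $A^{\pm}$ generating a subgroup $H$ of $F_n$, computes a context-free grammar with terminal alphabet $A^{\pm}$ that generates this language. -/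

import Mathlib

namespace DirectCocycles

/-- The direct sum relation `H ⊕ K = G`: the subgroups `H`, `K` generate `G` and meet trivially
(neither of them needs to be normal). -/
def IsDirectComplement {G : Type*} [Group G] (H K : Subgroup G) : Prop :=
  H ⊔ K = ⊤ ∧ H ⊓ K = ⊥

/-- The set of direct cocycles of `H`: all `u` with `H ⊕ ⟨u⟩ = G`. -/
def directCocycles {G : Type*} [Group G] (H : Subgroup G) : Set G :=
  {u | IsDirectComplement H (Subgroup.zpowers u)}

/-- The language of reduced forms of a subset of a free group, over the involutive alphabet
`α × Bool`, where `(a, true)` is the letter `a` and `(a, false)` is its formal inverse. -/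
def reducedForms {α : Type*} [DecidableEq α] (X : Set (FreeGroup α)) : Language (α × Bool) :=
  FreeGroup.toWord '' X

/-- A subset of a free group is context-free if its reduced forms form a context-free language. -/
def IsContextFreeSubset {α : Type*} [DecidableEq α] (X : Set (FreeGroup α)) : Prop :=
  (reducedForms X).IsContextFree

/-- A context-free grammar over the terminals `T`, as a finite piece of data: the initial
nonterminal and the list of productions. Nonterminals are named by natural numbers (only
the initial one and those occurring in the productions matter); in a right-hand side,
`Sum.inl t` is a terminal and `Sum.inr k` a nonterminal. -/
abbrev GrammarCode (T : Type*) : Type _ :=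
  ℕ × List (ℕ × List (T ⊕ ℕ))

namespace GrammarCode

/-- The rule `X → γ` described by a pair `(X, γ)`. -/
def toRule {T : Type*} (p : ℕ × List (T ⊕ ℕ)) : ContextFreeRule T ℕ where
  input := p.1
  output := p.2.map (Sum.elim Symbol.terminal Symbol.nonterminal)

/-- The context-free grammar described by a code. -/
def toGrammar {T : Type*} [DecidableEq T] (c : GrammarCode T) : ContextFreeGrammar T where
  NT := ℕ
  initial := c.1
  rules := (c.2.map toRule).toFinset

/-- Renaming of the terminals. -/
def mapTerminals {T T' : Type*} (φ : T → T') (c : GrammarCode T) : GrammarCode T' :=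
  (c.1, c.2.map fun p => (p.1, p.2.map (Sum.map φ id)))

end GrammarCode

/-- The letter `aᵢ^{±1}` as a pair consisting of the number `i` and a sign. -/
def letterCode {n : ℕ} (x : Fin n × Bool) : ℕ × Bool :=
  (x.1, x.2)

/-- The subgroup of the free group on `Fin n` generated by a finite list of (not necessarily
reduced) words. -/
def generatedSubgroup {n : ℕ} (S : List (List (Fin n × Bool))) : Subgroup (FreeGroup (Fin n)) :=
  Subgroup.closure {g | ∃ w ∈ S, FreeGroup.mk w = g}

end DirectCocycles

namespace DirectCocycles

open FreeGroup

/-! Free groups are torsion-free, so a reduced word `u` is a direct cocycle of `H` exactly when `H`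
and `u` generate the whole group and either `u = 1` or no positive power of `u` lies in `H`. Both
conditions are read off a finite piece of the Schreier graph of `H`, spanned by the cosets of the
prefixes of the generators.

Generation: if `H` and `u` generate everything, then `u = p x q` with a single letter `x`, where `p`
and the inverse of `q` are readable from the base vertex (`exists_split`). Otherwise an unreadable
middle segment of length at least two could be attached as a path without folding vertices together
(`exists_attach_path`). Extending the letters to permutations of the enlarged graph (`exists_hom`)
would give a point stabilizer that contains `H` and `u` but misses a prefix of `u`. Since generation
depends only on the double coset `H u H`, only the vertices at the two ends of `x` matter
(`generatesWith_split_iff`). A finite automaton with two copies of the graph therefore recognizes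
this condition (`run_passage_iff`).

Powers: write `u = p c p⁻¹` with `c` cyclically reduced. The words `p c ^ k p⁻¹` are then reduced,
and by pigeonhole some positive power of `u` lies in `H` exactly when `p c ^ N` is readable from the
base vertex, with `N` the number of vertices (`exists_pow_mem_iff`).

Both tests, as well as reducedness, depend only on the relations that `p`, `c` and `p⁻¹` induce on a
finite set of states (`accepts_iff`). A linear grammar produces `p` and `p⁻¹` from the outside
inwards, then `c`, and records these relations in its nonterminals; the empty word has its own rule
(`linearDerives_start_iff_of_lt`).

The grammar is computable because membership in `H` is: a word outside `H` is separated from it by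
an action on a number of points bounded in terms of the input, and all such actions can be
enumerated (`mem_wordSubgroup_iff`). Everything else is bounded search, so the whole construction is
primitive recursive (`primrec_cocycleCode`). -/

/-- The formal inverse of a letter. -/
def letterInv {α : Type*} (x : α × Bool) : α × Bool := (x.1, !x.2)

@[simp] theorem letterInv_letterInv {α : Type*} (x : α × Bool) : letterInv (letterInv x) = x := by
  simp [letterInv]

theorem letterInv_ne {α : Type*} (x : α × Bool) : letterInv x ≠ x := by
  intro h
  have := congrArg Prod.snd h
  simp [letterInv] at this

theorem eq_letterInv_comm {α : Type*} {x y : α × Bool} : x = letterInv y ↔ letterInv x = y := by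
  constructor
  · rintro rfl; simp
  · rintro rfl; simp

theorem reduced_pair_iff {α : Type*} {a b : α × Bool} :
    (a.1 = b.1 → a.2 = b.2) ↔ b ≠ letterInv a := by
  obtain ⟨a, s⟩ := a
  obtain ⟨b, t⟩ := b
  simp only [letterInv, ne_eq, Prod.mk.injEq, not_and]
  constructor
  · rintro h rfl
    cases s <;> cases t <;> simp_all
  · rintro h rfl
    cases s <;> cases t <;> simp_all

theorem invRev_cons_eq {α : Type*} (x : α × Bool) (w : List (α × Bool)) :
    invRev (x :: w) = invRev w ++ [letterInv x] := by
  simp [invRev, letterInv]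

/-- The subgroup generated by a list of words. -/
abbrev wordSubgroup {α : Type*} (S : List (List (α × Bool))) : Subgroup (FreeGroup α) :=
  Subgroup.closure {g | ∃ w ∈ S, FreeGroup.mk w = g}

/-! ### Runs in labelled graphs, and inverse graphs -/

/-- `Run E a w b` says that some path of the labelled graph `E` leads from `a` to `b` and has
label `w`. -/
def Run {V X : Type*} (E : V → X → V → Prop) : V → List X → V → Prop
  | a, [], b => a = b
  | a, x :: w, b => ∃ c, E a x c ∧ Run E c w b

section Run

variable {V W X : Type*} {E : V → X → V → Prop}

@[simp] theorem run_nil {a b : V} : Run E a [] b ↔ a = b := Iff.rfl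

theorem run_cons {a b : V} {x : X} {w : List X} :
    Run E a (x :: w) b ↔ ∃ c, E a x c ∧ Run E c w b := Iff.rfl

@[simp] theorem run_singleton {a b : V} {x : X} : Run E a [x] b ↔ E a x b := by
  simp [run_cons]

theorem run_append {a b : V} {u w : List X} :
    Run E a (u ++ w) b ↔ ∃ c, Run E a u c ∧ Run E c w b := by
  induction u generalizing a with
  | nil => simp
  | cons x u ih =>
    simp only [List.cons_append, run_cons, ih]
    constructor
    · rintro ⟨c, h, d, h1, h2⟩; exact ⟨d, ⟨c, h, h1⟩, h2⟩
    · rintro ⟨d, ⟨c, h, h1⟩, h2⟩; exact ⟨c, h, d, h1, h2⟩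

theorem Run.map {E' : W → X → W → Prop} (j : V → W)
    (hj : ∀ a x b, E a x b → E' (j a) x (j b)) {a b : V} {w : List X} (h : Run E a w b) :
    Run E' (j a) w (j b) := by
  induction w generalizing a with
  | nil => exact congrArg j h
  | cons x w ih =>
    obtain ⟨c, h1, h2⟩ := h
    exact ⟨j c, hj _ _ _ h1, ih h2⟩

end Run

/-- An inverse graph: edges can be reversed, and a vertex has at most one outgoing edge
for each letter. -/
structure IsInverseGraph {V α : Type*} (E : V → α × Bool → V → Prop) : Prop where
  symm : ∀ {a x b}, E a x b → E b (letterInv x) a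
  det : ∀ {a x b c}, E a x b → E a x c → b = c

namespace IsInverseGraph

variable {V α : Type*} {E : V → α × Bool → V → Prop}

theorem run_det (hE : IsInverseGraph E) {a b c : V} {w : List (α × Bool)}
    (h : Run E a w b) (h' : Run E a w c) : b = c := by
  induction w generalizing a with
  | nil => exact h.symm.trans h'
  | cons x w ih =>
    obtain ⟨d, h1, h2⟩ := h
    obtain ⟨d', h1', h2'⟩ := h'
    obtain rfl := hE.det h1 h1'
    exact ih h2 h2'

theorem run_invRev (hE : IsInverseGraph E) {a b : V} {w : List (α × Bool)}
    (h : Run E a w b) : Run E b (invRev w) a := by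
  induction w generalizing a with
  | nil => exact h.symm
  | cons x w ih =>
    obtain ⟨c, h1, h2⟩ := h
    rw [invRev_cons_eq, run_append]
    exact ⟨c, ih h2, by simpa using hE.symm h1⟩

theorem run_codet (hE : IsInverseGraph E) {a b c : V} {w : List (α × Bool)}
    (h : Run E a w c) (h' : Run E b w c) : a = b :=
  hE.run_det (hE.run_invRev h) (hE.run_invRev h')

/-- After reading a letter and then its inverse, determinism forces the path back to where it was,
so a cancelling pair can be cut out. -/
theorem run_of_red (hE : IsInverseGraph E) {a b : V} {w w' : List (α × Bool)}
    (hw : Red w w') (h : Run E a w b) : Run E a w' b := by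
  induction hw with
  | refl => exact h
  | tail _ hs ih =>
    obtain @⟨L₁, L₂, x, s⟩ := hs
    obtain ⟨c, h1, d, h2, e, h3, h4⟩ := run_append.1 ih
    obtain rfl : c = e := hE.det (hE.symm h2) h3
    exact run_append.2 ⟨c, h1, h4⟩

/-- Closed paths can be concatenated and reversed, so every element of the subgroup is the label of
some closed path at `o`; free reduction keeps that path closed. -/
theorem run_of_mem_closure [DecidableEq α] (hE : IsInverseGraph E) {o : V}
    {S : List (List (α × Bool))} (hS : ∀ s ∈ S, Run E o s o) {w : List (α × Bool)}
    (hw : IsReduced w) (h : FreeGroup.mk w ∈ wordSubgroup S) :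
    Run E o w o := by
  have key : ∀ g ∈ wordSubgroup S, ∃ v, FreeGroup.mk v = g ∧ Run E o v o := by
    intro g hg
    induction hg using Subgroup.closure_induction with
    | mem g hg => obtain ⟨s, hs, rfl⟩ := hg; exact ⟨s, rfl, hS s hs⟩
    | one => exact ⟨[], rfl, rfl⟩
    | mul g g' _ _ ih ih' =>
      obtain ⟨v, rfl, h⟩ := ih
      obtain ⟨v', rfl, h'⟩ := ih'
      exact ⟨v ++ v', rfl, run_append.2 ⟨o, h, h'⟩⟩
    | inv g _ ih =>
      obtain ⟨v, rfl, h⟩ := ih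
      exact ⟨invRev v, rfl, hE.run_invRev h⟩
  obtain ⟨v, hv, hr⟩ := key _ h
  have h2 : reduce v = w := by rw [← hw.reduce_eq]; exact reduce.sound hv
  exact hE.run_of_red (h2 ▸ reduce.red) hr

/-- Each generator is a partial bijection of a finite set and hence extends to a permutation. The
permutation carries the end of an edge to its start, so that a left action matches words read from
left to right. -/
theorem exists_hom [Finite V] (hE : IsInverseGraph E) :
    ∃ φ : FreeGroup α →* Equiv.Perm V, ∀ a w b, Run E a w b → φ (FreeGroup.mk w) b = a := by
  classical
  have := Fintype.ofFinite V
  have key : ∀ i : α, ∃ σ : Equiv.Perm V, ∀ a b, E a (i, true) b → σ b = a := by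
    intro i
    let f : V → V := fun b => if h : ∃ a, E a (i, true) b then h.choose else b
    have hf : ∀ a b, E a (i, true) b → f b = a := by
      intro a b h
      have h' : ∃ a, E a (i, true) b := ⟨a, h⟩
      simp only [f, dif_pos h']
      exact hE.det (hE.symm h'.choose_spec) (hE.symm h)
    obtain ⟨g, hg⟩ := Set.MapsTo.exists_equiv_extend_of_card_eq (α := V) (β := V)
      (t := Finset.univ) (by simp) (s := {b | ∃ a, E a (i, true) b}) (f := f)
      (by intro b _; simp) (by
        rintro b ⟨a, h⟩ b' ⟨a', h'⟩ hb
        rw [hf _ _ h, hf _ _ h'] at hb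
        subst hb
        exact hE.det h h')
    refine ⟨g.trans (Equiv.subtypeUnivEquiv (by simp)), fun a b h => ?_⟩
    rw [← hf _ _ h, ← hg b ⟨a, h⟩]
    rfl
  choose σ hσ using key
  refine ⟨FreeGroup.lift σ, ?_⟩
  intro a w b h
  induction w generalizing a with
  | nil => simp [← FreeGroup.one_eq_mk, h.symm]
  | cons x w ih =>
    obtain ⟨c, h1, h2⟩ := h
    have e : FreeGroup.mk (x :: w) = FreeGroup.mk [x] * FreeGroup.mk w := rfl
    rw [e, _root_.map_mul, Equiv.Perm.mul_apply, ih c h2]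
    obtain ⟨i, s⟩ := x
    cases s
    · have := hσ i c a (hE.symm h1)
      simp [Equiv.symm_apply_eq, this]
    · simpa using hσ i a c h1

end IsInverseGraph

/-! ### Attaching paths to inverse graphs -/

/-- The graph `E` with an edge from `v` to `v'` labelled by `x`, and its reverse, added. -/
def addEdge {V α : Type*} (E : V → α × Bool → V → Prop) (v : V) (x : α × Bool) (v' : V) :
    V → α × Bool → V → Prop :=
  fun a y b => E a y b ∨ (a = v ∧ y = x ∧ b = v') ∨ (a = v' ∧ y = letterInv x ∧ b = v)

theorem IsInverseGraph.addEdge {V α : Type*} {E : V → α × Bool → V → Prop}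
    (hE : IsInverseGraph E) {v v' : V} {x : α × Bool} (h : ∀ c, ¬ E v x c)
    (h' : ∀ c, ¬ E v' (letterInv x) c) : IsInverseGraph (addEdge E v x v') where
  symm := by
    rintro a y b (hab | ⟨rfl, rfl, rfl⟩ | ⟨rfl, rfl, rfl⟩)
    · exact Or.inl (hE.symm hab)
    · exact Or.inr (Or.inr ⟨rfl, rfl, rfl⟩)
    · exact Or.inr (Or.inl ⟨rfl, by simp, rfl⟩)
  det := by
    rintro a y b c (hab | ⟨rfl, rfl, rfl⟩ | ⟨rfl, rfl, rfl⟩) (hac | ⟨h1, h2, h3⟩ | ⟨h1, h2, h3⟩)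
    · exact hE.det hab hac
    · subst h1 h2; exact absurd hab (h _)
    · subst h1 h2; exact absurd hab (h' _)
    · exact absurd hac (h _)
    · exact h3.symm
    · exact absurd h2.symm (letterInv_ne _)
    · exact absurd hac (h' _)
    · exact absurd h2 (letterInv_ne _)
    · exact h3.symm

/-- The graph `E` with an isolated vertex `none` added. -/
def addVertex {V X : Type*} (E : V → X → V → Prop) : Option V → X → Option V → Prop :=
  fun a x b => ∃ a' b', a = some a' ∧ b = some b' ∧ E a' x b'

theorem IsInverseGraph.addVertex {V α : Type*} {E : V → α × Bool → V → Prop}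
    (hE : IsInverseGraph E) : IsInverseGraph (addVertex E) where
  symm := by
    rintro _ y _ ⟨a, b, rfl, rfl, h⟩
    exact ⟨b, a, rfl, rfl, hE.symm h⟩
  det := by
    rintro _ y _ _ ⟨a, b, rfl, rfl, h⟩ ⟨a', c, h1, rfl, h'⟩
    obtain rfl := Option.some.inj h1
    rw [hE.det h h']

/-- A path with a reduced label `m` can be attached at `v` and `v'` without identifying vertices,
provided that neither end of it can be folded onto the graph. -/
theorem exists_attach_path {α : Type*} (k : ℕ) :
    ∀ {V : Type} [Finite V] {E : V → α × Bool → V → Prop} (_ : IsInverseGraph E)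
      {m : List (α × Bool)} (_ : m.length = k) (_ : m ≠ []) (_ : IsReduced m) (v v' : V)
      (_ : ∀ x ∈ m.head?, ∀ c, ¬ E v x c) (_ : ∀ x ∈ m.getLast?, ∀ c, ¬ E v' (letterInv x) c),
      ∃ (W : Type) (_ : Finite W) (E' : W → α × Bool → W → Prop) (j : V → W),
        Function.Injective j ∧ IsInverseGraph E' ∧ (∀ a x b, E a x b → E' (j a) x (j b)) ∧
        Run E' (j v) m (j v') ∧
        (2 ≤ m.length → ∃ t ∉ Set.range j, ∃ x ∈ m.head?, E' (j v) x t) := by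
  induction k using Nat.strong_induction_on with
  | _ k ih =>
  intro V _ E hE m hk hm hred v v' hv hv'
  match m, hm with
  | [x], _ =>
    refine ⟨V, inferInstance, addEdge E v x v', id, Function.injective_id,
      hE.addEdge (hv x (by simp)) (hv' x (by simp)), fun a y b h => Or.inl h, ?_, by simp⟩
    simp [addEdge]
  | x :: y :: m, _ =>
    -- The first letter leads to a fresh vertex `none`, whose only outgoing edge is the one back to
    -- `v`. The rest of the path is then attached at `none` by induction.
    have hE₁ : IsInverseGraph (addEdge (addVertex E) (some v) x none) := by
      refine hE.addVertex.addEdge ?_ ?_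
      · rintro c ⟨a, b, h1, rfl, h2⟩
        obtain rfl := Option.some.inj h1
        exact hv x (by simp) _ h2
      · rintro c ⟨a, b, h1, _⟩
        simp at h1
    have hnone : ∀ z c, addEdge (addVertex E) (some v) x none none z c → z = letterInv x := by
      rintro z c (⟨a, b, h1, _⟩ | ⟨h1, _⟩ | ⟨_, h1, _⟩)
      · simp at h1
      · simp at h1
      · exact h1
    have hlift : ∀ a z b, E a z b →
        addEdge (addVertex E) (some v) x none (some a) z (some b) :=
      fun a z b h => Or.inl ⟨a, b, rfl, rfl, h⟩
    have hx : addEdge (addVertex E) (some v) x none (some v) x none := Or.inr (Or.inl (by simp))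
    obtain ⟨hxy, hred'⟩ := isReduced_cons_cons.1 hred
    rw [reduced_pair_iff] at hxy
    obtain ⟨m', z, hz⟩ : ∃ m' z, y :: m = m' ++ [z] := by
      rcases List.eq_nil_or_concat (y :: m) with h | ⟨m', z, h⟩
      · simp at h
      · exact ⟨m', z, by simpa using h⟩
    -- The far end can fold only onto the edge just added. In that case the path has the shape of a
    -- lollipop: `x` is the stick, and the middle part `m'` is attached as a loop at `none`. It is
    -- shorter by two letters, whence strong induction.
    by_cases hcase : v = v' ∧ letterInv z = x
    · obtain ⟨rfl, hzx⟩ := hcase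
      have hm' : m' ≠ [] := by
        rintro rfl
        simp only [List.nil_append, List.cons.injEq] at hz
        apply hxy
        rw [hz.1, ← hzx]; simp
      have hlen : m'.length < k := by
        have := congrArg List.length hz
        simp at this hk; omega
      have hhead : m'.head? = some y := by
        cases m' with
        | nil => simp at hm'
        | cons a m' => simp at hz; simp [hz.1]
      rw [hz] at hred'
      obtain ⟨W, hW, E', j, hj, hE', hjE, hrun, -⟩ := ih m'.length hlen hE₁ rfl hm'
        (hred'.infix (List.prefix_append _ _).isInfix) none none
        (by
          intro a ha c hc
          rw [hhead] at ha
          obtain rfl : y = a := by simpa using ha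
          exact hxy (hnone _ _ hc))
        (by
          intro a ha c hc
          have h1 := hnone _ _ hc
          have h2 := (List.isChain_append.1 hred').2.2 a ha z (by simp)
          rw [reduced_pair_iff] at h2
          exact h2 (by rw [h1, ← hzx]; simp))
      refine ⟨W, hW, E', j ∘ some, hj.comp (Option.some_injective _), hE',
        fun a w b h => hjE _ _ _ (hlift _ _ _ h), ?_,
        fun _ => ⟨j none, ?_, x, by simp, hjE _ _ _ hx⟩⟩
      · rw [hz]
        refine ⟨j none, hjE _ _ _ hx, run_append.2 ⟨j none, hrun, ?_⟩⟩
        rw [run_singleton, eq_letterInv_comm.2 hzx.symm.symm]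
        exact hE'.symm (hjE _ _ _ hx)
      · rintro ⟨a, ha⟩
        simpa using hj ha
    · obtain ⟨W, hW, E', j, hj, hE', hjE, hrun, -⟩ := ih (y :: m).length (by simp at hk ⊢; omega)
        hE₁ rfl (by simp) hred' none (some v')
        (by
          intro a ha c hc
          obtain rfl : y = a := by simpa using ha
          exact hxy (hnone _ _ hc))
        (by
          rw [hz]
          rintro a ha c (⟨p, q, h1, rfl, h2⟩ | ⟨h1, h2, -⟩ | ⟨h1, -⟩)
          · obtain rfl := Option.some.inj h1
            exact hv' a (by rw [List.getLast?_cons_cons, hz]; exact ha) _ h2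
          · obtain rfl : z = a := by simpa using ha
            exact hcase ⟨(Option.some.inj h1).symm, h2⟩
          · simp at h1)
      refine ⟨W, hW, E', j ∘ some, hj.comp (Option.some_injective _), hE',
        fun a w b h => hjE _ _ _ (hlift _ _ _ h), ⟨j none, hjE _ _ _ hx, hrun⟩,
        fun _ => ⟨j none, ?_, x, by simp, hjE _ _ _ hx⟩⟩
      rintro ⟨a, ha⟩
      simpa using hj ha

/-! ### Reading generation and powers off a finite inverse graph -/

namespace IsInverseGraph

variable {α : Type*}

/-- If a reduced word `u` and the loops of a finite inverse graph generate all prefixes of `u`,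
then `u` is read in the graph from both ends, up to one letter. -/
theorem exists_split {V : Type} [Finite V] {E : V → α × Bool → V → Prop} (hE : IsInverseGraph E)
    {o : V} {S : List (List (α × Bool))} (hS : ∀ s ∈ S, Run E o s o) {u : List (α × Bool)}
    (hu : IsReduced u) (hne : u ≠ [])
    (hgen : ∀ p, p <+: u → FreeGroup.mk p ∈ wordSubgroup (u :: S)) :
    ∃ p x q, u = p ++ x :: q ∧ (∃ a, Run E o p a) ∧ ∃ b, Run E o (invRev q) b := by
  -- the longest readable prefix
  have h1 : ∀ w : List (α × Bool), w ≠ [] → ∃ p x q, w = p ++ x :: q ∧ ∃ a, Run E o p a ∧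
      (q ≠ [] → ∀ c, ¬ E a x c) := by
    intro w hw
    induction w using List.reverseRecOn with
    | nil => simp at hw
    | append_singleton w x ih =>
      by_cases hw0 : w = []
      · exact ⟨[], x, [], by simp [hw0], o, rfl, by simp⟩
      obtain ⟨p, y, q, rfl, a, ha, hq⟩ := ih hw0
      by_cases hc : ∃ c, E a y c
      · obtain ⟨c, hc⟩ := hc
        by_cases hq0 : q = []
        · subst hq0
          exact ⟨p ++ [y], x, [], by simp, c, run_append.2 ⟨a, ha, by simpa using hc⟩, by simp⟩
        · exact absurd hc (hq hq0 c)
      · exact ⟨p, y, q ++ [x], by simp, a, ha, fun _ c h => hc ⟨c, h⟩⟩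
  -- The longest readable prefix is taken of `u` here and of its inverse below. If one of the two
  -- reaches up to the last letter, the split is found.
  obtain ⟨p, x, r, rfl, a, ha, hx⟩ := h1 u hne
  by_cases hr : r = []
  · subst hr
    exact ⟨p, x, [], rfl, ⟨a, ha⟩, o, rfl⟩
  obtain ⟨q, y, t, hqt, b, hb, hy⟩ := h1 (invRev (x :: r)) (by simp [invRev])
  have hxr : x :: r = invRev t ++ letterInv y :: invRev q := by
    rw [← invRev_invRev (L₁ := x :: r), hqt, invRev_append, invRev_cons_eq]; simp
  by_cases ht : t = []
  · subst ht
    simp only [invRev_empty, List.nil_append, List.cons.injEq] at hxr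
    exact ⟨p, x, r, rfl, ⟨a, ha⟩, b, by rw [hxr.2]; simpa using hb⟩
  exfalso
  -- Now `u = p m q⁻¹` with `m` of length at least two, and neither end of `m` continues in the
  -- graph.
  set m := invRev t ++ [letterInv y] with hm
  have hm2 : 2 ≤ m.length := by
    have := List.length_pos_of_ne_nil ht
    simp [hm]; omega
  have hmx : m.head? = some x := by
    have := congrArg List.head? hxr
    rw [show invRev t ++ letterInv y :: invRev q = m ++ invRev q by simp [hm]] at this
    rw [List.head?_append_of_ne_nil _ (by simp [hm])] at this
    simpa using this.symm
  have hsplit : p ++ x :: r = p ++ (m ++ invRev q) := by rw [hxr]; simp [hm]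
  obtain ⟨W, hW, E', j, hj, hE', hjE, hrun, ht'⟩ := exists_attach_path m.length hE (m := m) rfl
    (by simp [hm]) (hu.infix ⟨p, invRev q, by rw [hsplit]; simp⟩) a b
    (by
      intro z hz
      obtain rfl : x = z := by simpa [hmx] using hz
      exact hx hr)
    (by
      intro z hz
      obtain rfl : letterInv y = z := by simpa [hm] using hz
      simpa using hy ht)
  obtain ⟨c, hc, z, hz, hzc⟩ := ht' hm2
  obtain rfl : x = z := by simpa [hmx] using hz
  obtain ⟨φ, hφ⟩ := hE'.exists_hom
  -- In the enlarged graph both `u` and the words of `S` label loops at the base, so the subgroup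
  -- they generate fixes it. By `hgen` this includes the prefix `p x`, which however leads from the
  -- base to the new vertex `c`.
  have hstab : wordSubgroup ((p ++ x :: r) :: S) ≤
      (MulAction.stabilizer (Equiv.Perm W) (j o)).comap φ := by
    rw [Subgroup.closure_le]
    rintro _ ⟨s, hs, rfl⟩
    refine hφ _ _ _ ?_
    rcases List.mem_cons.1 hs with rfl | hs
    · rw [hsplit, run_append]
      exact ⟨j a, ha.map j hjE, run_append.2 ⟨j b, hrun, hE'.run_invRev (hb.map j hjE) ⟩⟩
    · exact (hS s hs).map j hjE
  have h2 : φ (FreeGroup.mk (p ++ [x])) (j o) = j o := hstab (hgen _ ⟨r, by simp⟩)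
  have h3 : φ (FreeGroup.mk (p ++ [x])) c = j o :=
    hφ _ _ _ (run_append.2 ⟨j a, ha.map j hjE, by simpa using hzc⟩)
  exact hc ⟨o, (φ _).injective (h2.trans h3.symm)⟩

/-- Some positive power of `p c p⁻¹` is a loop if and only if sufficiently many copies of `c`
can be read after `p`. -/
theorem exists_pow_mem_iff [DecidableEq α] {V : Type} [Fintype V] {E : V → α × Bool → V → Prop}
    (hE : IsInverseGraph E) {o : V} {S : List (List (α × Bool))} (hS : ∀ s ∈ S, Run E o s o)
    (hsound : ∀ w, Run E o w o → FreeGroup.mk w ∈ wordSubgroup S)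
    {p c : List (α × Bool)} (hu : IsReduced (p ++ c ++ invRev p)) (hc : IsCyclicallyReduced c) :
    (∃ k, k ≠ 0 ∧ FreeGroup.mk (p ++ c ++ invRev p) ^ k ∈
        wordSubgroup S) ↔
      ∃ b, Run E o (p ++ (List.replicate (Fintype.card V) c).flatten) b := by
  have hpow : ∀ k, FreeGroup.mk (p ++ c ++ invRev p) ^ k =
      FreeGroup.mk (p ++ (List.replicate k c).flatten ++ invRev p) := by
    intro k
    have h1 : ∀ w, FreeGroup.mk (p ++ w ++ invRev p) =
        FreeGroup.mk p * FreeGroup.mk w * (FreeGroup.mk p)⁻¹ := fun w => rfl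
    rw [h1, h1, conj_pow, pow_mk]
  constructor
  · rintro ⟨k, hk, h⟩
    have hV : 0 < Fintype.card V := Fintype.card_pos_iff.2 ⟨o⟩
    -- Passing to the multiple `k * card V` of the exponent makes it at least `card V`.
    have h' := Subgroup.pow_mem _ h (Fintype.card V)
    rw [← pow_mul, hpow] at h'
    have hrun := hE.run_of_mem_closure hS
      (IsReduced.append_flatten_replicate_append hc hu
        (Nat.mul_ne_zero hk hV.ne')) h'
    obtain ⟨l, hl⟩ : ∃ l, k * Fintype.card V = Fintype.card V + l :=
      Nat.exists_eq_add_of_le (Nat.le_mul_of_pos_left _ (Nat.pos_of_ne_zero hk))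
    rw [hl, List.replicate_add, List.flatten_append, List.append_assoc, List.append_assoc,
      ← List.append_assoc, run_append] at hrun
    obtain ⟨b, hb, -⟩ := hrun
    exact ⟨b, hb⟩
  · rintro ⟨b, hb⟩
    obtain ⟨v, hv, hvb⟩ := run_append.1 hb
    have hf : ∀ i : Fin (Fintype.card V + 1), ∃ d, Run E v (List.replicate i c).flatten d := by
      intro i
      obtain ⟨l, hl⟩ := Nat.exists_eq_add_of_le (Nat.lt_succ_iff.1 i.2)
      rw [hl, List.replicate_add, List.flatten_append, run_append] at hvb
      obtain ⟨d, hd, -⟩ := hvb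
      exact ⟨d, hd⟩
    choose f hf using hf
    -- The `card V + 1` vertices reached after `0, …, card V` copies of `c` cannot be distinct.
    -- Reading backwards from a coincidence closes a loop at `v` itself, labelled by the difference
    -- of the two powers.
    obtain ⟨i, j, hij, hfij⟩ := Fintype.exists_ne_map_eq_of_card_lt f (by simp)
    wlog hlt : i < j generalizing i j
    · exact this j i hij.symm hfij.symm (lt_of_le_of_ne (not_lt.1 hlt) hij.symm)
    obtain ⟨l, hl⟩ : ∃ l, (j : ℕ) = l + i := ⟨j - i, (Nat.sub_add_cancel hlt.le).symm⟩
    have hj := hf j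
    rw [hl, List.replicate_add, List.flatten_append, run_append] at hj
    obtain ⟨y, hy, hyj⟩ := hj
    obtain rfl : v = y := hE.run_codet (hfij ▸ hf i) hyj
    refine ⟨l, ?_, ?_⟩
    · rintro rfl
      simp only [Nat.zero_add] at hl
      exact hij (Fin.ext hl.symm)
    · rw [hpow]
      exact hsound _ (run_append.2 ⟨v, run_append.2 ⟨v, hv, hy⟩, hE.run_invRev hv⟩)

end IsInverseGraph

/-! ### A finite part of the Schreier graph -/

/-- The list of prefixes of a word. -/
def prefixes {X : Type*} (w : List X) : List (List X) :=
  (List.range (w.length + 1)).map fun k => w.take k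

theorem mem_prefixes {X : Type*} {p w : List X} : p ∈ prefixes w ↔ p <+: w := by
  simp only [prefixes, List.mem_map, List.mem_range]
  constructor
  · rintro ⟨k, _, rfl⟩; exact List.take_prefix _ _
  · intro h
    exact ⟨p.length, Nat.lt_succ_iff.2 h.length_le, (List.prefix_iff_eq_take.1 h).symm⟩

/-- The words that name the vertices of the Schreier graph which are visited by the words
of `S`. -/
def vertexWords {X : Type*} (S : List (List X)) : List (List X) := [] :: S.flatMap prefixes

theorem mem_vertexWords {X : Type*} {S : List (List X)} {s p : List X} (hs : s ∈ S)
    (hp : p <+: s) : p ∈ vertexWords S :=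
  List.mem_cons_of_mem _ (List.mem_flatMap.2 ⟨s, hs, mem_prefixes.2 hp⟩)

/-- Two words lie in the same right coset of `H`. -/
def SameCoset {α : Type*} (H : Subgroup (FreeGroup α)) (u v : List (α × Bool)) : Prop :=
  FreeGroup.mk u * (FreeGroup.mk v)⁻¹ ∈ H

namespace SameCoset

variable {α : Type*} {H : Subgroup (FreeGroup α)} {u v w : List (α × Bool)}

theorem refl (u : List (α × Bool)) : SameCoset H u u := by
  unfold SameCoset
  rw [mul_inv_cancel]
  exact H.one_mem

theorem symm (h : SameCoset H u v) : SameCoset H v u := by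
  unfold SameCoset at *
  have := H.inv_mem h
  rwa [mul_inv_rev, _root_.inv_inv] at this

theorem trans (h : SameCoset H u v) (h' : SameCoset H v w) : SameCoset H u w := by
  unfold SameCoset at *
  have := H.mul_mem h h'
  rwa [mul_assoc, inv_mul_cancel_left] at this

theorem append (h : SameCoset H u v) (w : List (α × Bool)) : SameCoset H (u ++ w) (v ++ w) := by
  unfold SameCoset at *
  rw [← mul_mk, ← mul_mk]
  group at h ⊢
  exact h

theorem nil_right : SameCoset H u [] ↔ FreeGroup.mk u ∈ H := by
  unfold SameCoset
  rw [← FreeGroup.one_eq_mk, inv_one, mul_one]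

end SameCoset

section Schreier

variable {α : Type*} (H : Subgroup (FreeGroup α)) (L : List (List (α × Bool)))

/-- The `i`-th word of `L` is the first one in its right coset. -/
def IsFirstRep (i : Fin L.length) : Prop := ∀ j < i, ¬ SameCoset H L[j] L[i]

/-- The part of the Schreier graph of `H` spanned by the cosets of the words of `L`. A coset
is represented by the first index of a word of `L` in it. -/
def schreierGraph (i : Fin L.length) (x : α × Bool) (j : Fin L.length) : Prop :=
  IsFirstRep H L i ∧ IsFirstRep H L j ∧ SameCoset H (L[i] ++ [x]) L[j]

variable {H L}

theorem IsFirstRep.eq {i j : Fin L.length} (hi : IsFirstRep H L i) (hj : IsFirstRep H L j)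
    (h : SameCoset H L[i] L[j]) : i = j := by
  rcases lt_trichotomy i j with hlt | heq | hgt
  · exact absurd h (hj i hlt)
  · exact heq
  · exact absurd h.symm (hi j hgt)

theorem exists_isFirstRep {v : List (α × Bool)} (hv : v ∈ L) :
    ∃ i : Fin L.length, IsFirstRep H L i ∧ SameCoset H v L[i] := by
  obtain ⟨k, hk, rfl⟩ := List.getElem_of_mem hv
  obtain ⟨i, hi, hmin⟩ := wellFounded_lt.has_min
    {i : Fin L.length | SameCoset H L[k] L[i]} ⟨⟨k, hk⟩, SameCoset.refl _⟩
  exact ⟨i, fun j hj h => hmin j (SameCoset.trans hi h.symm) hj, hi⟩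

theorem isInverseGraph_schreierGraph : IsInverseGraph (schreierGraph H L) where
  symm := by
    rintro i x j ⟨hi, hj, h⟩
    refine ⟨hj, hi, (h.symm.append [letterInv x]).trans ?_⟩
    have : FreeGroup.mk (L[i] ++ [x] ++ [letterInv x]) = FreeGroup.mk L[i] := by
      have h1 : FreeGroup.mk [letterInv x] = (FreeGroup.mk [x])⁻¹ := rfl
      rw [← mul_mk, ← mul_mk, h1, mul_inv_cancel_right]
    unfold SameCoset
    rw [this, mul_inv_cancel]
    exact H.one_mem
  det := by
    rintro i x j k ⟨_, hj, h⟩ ⟨_, hk, h'⟩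
    exact hj.eq hk (h.symm.trans h')

theorem sameCoset_of_run {i j : Fin L.length} {w : List (α × Bool)}
    (h : Run (schreierGraph H L) i w j) : SameCoset H (L[i] ++ w) L[j] := by
  induction w generalizing i with
  | nil => rw [run_nil.1 h, List.append_nil]; exact SameCoset.refl _
  | cons x w ih =>
    obtain ⟨k, ⟨_, _, h1⟩, h2⟩ := h
    have := (h1.append w).trans (ih h2)
    simpa using this

theorem isFirstRep_of_run {i j : Fin L.length} {w : List (α × Bool)} (hi : IsFirstRep H L i)
    (h : Run (schreierGraph H L) i w j) : IsFirstRep H L j := by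
  induction w generalizing i with
  | nil => rwa [← run_nil.1 h]
  | cons x w ih =>
    obtain ⟨k, ⟨_, hk, _⟩, h2⟩ := h
    exact ih hk h2

/-- A path in the full Schreier graph stays in the chosen part as long as the coset of every prefix
has a representative in `L`. -/
theorem exists_run {i : Fin L.length} (hi : IsFirstRep H L i) {w : List (α × Bool)}
    (h : ∀ p, p <+: w → ∃ v ∈ L, SameCoset H (L[i] ++ p) v) :
    ∃ j, Run (schreierGraph H L) i w j := by
  induction w generalizing i with
  | nil => exact ⟨i, rfl⟩
  | cons x w ih =>
    obtain ⟨v, hv, hv'⟩ := h [x] ⟨w, rfl⟩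
    obtain ⟨k, hk, hvk⟩ := exists_isFirstRep (H := H) hv
    have hik := hv'.trans hvk
    obtain ⟨j, hj⟩ := ih hk (by
      intro p hp
      obtain ⟨v', hv', h'⟩ := h (x :: p) (by simpa using hp)
      refine ⟨v', hv', (hik.symm.append p).trans ?_⟩
      simpa using h')
    exact ⟨j, k, ⟨hi, hk, hik⟩, hj⟩

end Schreier

section Base

variable {α : Type*} (H : Subgroup (FreeGroup α)) {S : List (List (α × Bool))}

/-- The base vertex. -/
def baseVertex {X : Type*} (S : List (List X)) : Fin (vertexWords S).length :=
  ⟨0, by simp [vertexWords]⟩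

@[simp] theorem getElem_baseVertex {X : Type*} (S : List (List X)) :
    (vertexWords S)[baseVertex S] = [] := rfl

theorem isFirstRep_baseVertex : IsFirstRep H (vertexWords S) (baseVertex S) :=
  fun j hj => absurd hj (Nat.not_lt_zero j)

theorem exists_run_baseVertex {s : List (α × Bool)} (hs : s ∈ S) :
    ∃ j, Run (schreierGraph H (vertexWords S)) (baseVertex S) s j :=
  exists_run (isFirstRep_baseVertex H) fun p hp =>
    ⟨p, mem_vertexWords hs hp, SameCoset.refl _⟩

variable {H}

/-- Different first representatives lie in different cosets, and the base vertex stands for the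
coset `H` itself. -/
theorem run_baseVertex_iff {w : List (α × Bool)} {j : Fin (vertexWords S).length}
    (h : Run (schreierGraph H (vertexWords S)) (baseVertex S) w j) :
    j = baseVertex S ↔ FreeGroup.mk w ∈ H := by
  have h1 := sameCoset_of_run h
  rw [getElem_baseVertex, List.nil_append] at h1
  constructor
  · rintro rfl
    exact SameCoset.nil_right.1 h1
  · intro hw
    exact (isFirstRep_of_run (isFirstRep_baseVertex H) h).eq (isFirstRep_baseVertex H)
      (h1.symm.trans (SameCoset.nil_right.2 hw))

theorem run_baseVertex_of_mem {s : List (α × Bool)} (hs : s ∈ S) (h : FreeGroup.mk s ∈ H) :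
    Run (schreierGraph H (vertexWords S)) (baseVertex S) s (baseVertex S) := by
  obtain ⟨j, hj⟩ := exists_run_baseVertex H hs
  rwa [(run_baseVertex_iff hj).2 h] at hj

theorem mk_mem_wordSubgroup {s : List (α × Bool)} (hs : s ∈ S) :
    FreeGroup.mk s ∈ wordSubgroup S :=
  Subgroup.subset_closure ⟨s, hs, rfl⟩

/-- A word outside a finitely generated subgroup is separated from it by an action on
the vertices visited by the generators and the word. -/
theorem exists_separating_hom {w : List (α × Bool)} (hw : FreeGroup.mk w ∉ wordSubgroup S) :
    ∃ φ : FreeGroup α →* Equiv.Perm (Fin (vertexWords (w :: S)).length),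
      (∀ s ∈ S, φ (FreeGroup.mk s) (baseVertex _) = baseVertex _) ∧
      φ (FreeGroup.mk w) (baseVertex _) ≠ baseVertex _ := by
  obtain ⟨φ, hφ⟩ := (isInverseGraph_schreierGraph (H := wordSubgroup S)
    (L := vertexWords (w :: S))).exists_hom
  refine ⟨φ, fun s hs => hφ _ _ _ (run_baseVertex_of_mem (List.mem_cons_of_mem _ hs)
    (mk_mem_wordSubgroup hs)), fun h => hw ?_⟩
  obtain ⟨j, hj⟩ := exists_run_baseVertex (wordSubgroup S) (List.mem_cons_self (a := w) (l := S))
  exact (run_baseVertex_iff hj).1 ((φ _).injective ((hφ _ _ _ hj).trans h.symm))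

end Base

/-! ### Testing membership by finite permutation tables -/

/-- The letters with index below `n`. -/
def lettersBelow (n : ℕ) : List (ℕ × Bool) :=
  (List.range n).flatMap fun i => [(i, true), (i, false)]

@[simp] theorem mem_lettersBelow {n : ℕ} {x : ℕ × Bool} : x ∈ lettersBelow n ↔ x.1 < n := by
  obtain ⟨i, s⟩ := x
  cases s <;> simp [lettersBelow]

/-- A strict upper bound of the indices of the letters in a list of words. -/
def letterBound (L : List (List (ℕ × Bool))) : ℕ :=
  L.flatten.foldr (fun x m => x.1 + m + 1) 0

theorem lt_letterBound {L : List (List (ℕ × Bool))} {w : List (ℕ × Bool)} (hw : w ∈ L)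
    {x : ℕ × Bool} (hx : x ∈ w) : x.1 < letterBound L := by
  have key : ∀ l : List (ℕ × Bool), x ∈ l → x.1 < l.foldr (fun x m => x.1 + m + 1) 0 := by
    intro l hl
    induction l with
    | nil => simp at hl
    | cons y l ih =>
      simp only [List.foldr_cons]
      rcases List.mem_cons.1 hl with rfl | hl
      · omega
      · have := ih hl; omega
  exact key _ (List.mem_flatten.2 ⟨w, hw, hx⟩)

/-- The words of length at most `k` over `L`. -/
def listsUpTo {X : Type*} (L : List X) (k : ℕ) : List (List X) :=
  k.rec [[]] fun _ W => [] :: W.flatMap fun w => L.map fun a => a :: w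

theorem mem_listsUpTo {X : Type*} {L : List X} {k : ℕ} {w : List X} (hk : w.length ≤ k)
    (hw : ∀ a ∈ w, a ∈ L) : w ∈ listsUpTo L k := by
  induction k generalizing w with
  | zero => simp [List.length_eq_zero_iff.1 (Nat.le_zero.1 hk), listsUpTo]
  | succ k ih =>
    cases w with
    | nil => exact List.mem_cons_self
    | cons a w =>
      refine List.mem_cons_of_mem _ (List.mem_flatMap.2 ⟨w, ih (by simpa using hk) ?_, ?_⟩)
      · exact fun b hb => hw b (List.mem_cons_of_mem _ hb)
      · exact List.mem_map.2 ⟨a, hw a List.mem_cons_self, rfl⟩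

/-- The value at `v` of the function assigned to the letter `x` by a table whose rows number
`2 i + 1` and `2 i` list the values for `aᵢ` and its inverse. -/
def lookup (t : List (List ℕ)) (x : ℕ × Bool) (v : ℕ) : ℕ :=
  (t.getD (2 * x.1 + x.2.toNat) []).getD v 0

/-- The letters of `w` act one after the other on `v`. -/
def actWord (t : List (List ℕ)) (w : List (ℕ × Bool)) (v : ℕ) : ℕ :=
  w.foldl (fun v x => lookup t x v) v

/-- The letters with index below `b` act as mutually inverse permutations of `{0, …, N - 1}`. -/
def IsPermTable (b N : ℕ) (t : List (List ℕ)) : Prop :=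
  ∀ x ∈ lettersBelow b, ∀ v ∈ List.range N,
    lookup t x v < N ∧ lookup t (letterInv x) (lookup t x v) = v

/-- In every action on `N` points by tables, `w` fixes the point `0` if all words of `S` do. -/
def FixesBase (b N : ℕ) (S : List (List (ℕ × Bool))) (w : List (ℕ × Bool)) : Prop :=
  ∀ t ∈ listsUpTo (listsUpTo (List.range N) N) (2 * b), IsPermTable b N t →
    (∀ s ∈ S, actWord t s 0 = 0) → actWord t w 0 = 0

/-- A permutation table is an inverse graph on `Fin N`, hence comes from a homomorphism to
permutations; the stabilizer of the point `0` is a subgroup that contains `S`. -/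
theorem fixesBase_of_mem {b N : ℕ} {S : List (List (ℕ × Bool))} {w : List (ℕ × Bool)}
    (hN : 0 < N) (hb : ∀ s ∈ w :: S, ∀ x ∈ s, x.1 < b)
    (h : FreeGroup.mk w ∈ wordSubgroup S) : FixesBase b N S w := by
  intro t _ ht hS
  let E : Fin N → ℕ × Bool → Fin N → Prop := fun i x j => x.1 < b ∧ lookup t x i = j
  have ht' : ∀ x : ℕ × Bool, x.1 < b → ∀ i : Fin N,
      lookup t x i < N ∧ lookup t (letterInv x) (lookup t x i) = i :=
    fun x hx i => ht x (by simpa using hx) i (by simp)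
  have hE : IsInverseGraph E :=
    { symm := by
        rintro i x j ⟨hx, hj⟩
        exact ⟨hx, by rw [← hj, (ht' x hx i).2]⟩
      det := by
        rintro i x j k ⟨_, hj⟩ ⟨_, hk⟩
        exact Fin.ext (hj.symm.trans hk) }
  obtain ⟨φ, hφ⟩ := hE.exists_hom
  have hrun : ∀ s : List (ℕ × Bool), (∀ x ∈ s, x.1 < b) → ∀ i : Fin N,
      ∃ j : Fin N, Run E i s j ∧ actWord t s i = j := by
    intro s
    induction s with
    | nil => exact fun _ i => ⟨i, rfl, rfl⟩
    | cons x s ih =>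
      intro hs i
      have hx := hs x List.mem_cons_self
      obtain ⟨j, hj, hj'⟩ := ih (fun y hy => hs y (List.mem_cons_of_mem _ hy))
        ⟨lookup t x i, (ht' x hx i).1⟩
      exact ⟨j, ⟨_, ⟨hx, rfl⟩, hj⟩, hj'⟩
  have hstab : wordSubgroup S ≤
      (MulAction.stabilizer (Equiv.Perm (Fin N)) (⟨0, hN⟩ : Fin N)).comap φ := by
    rw [Subgroup.closure_le]
    rintro _ ⟨s, hs, rfl⟩
    obtain ⟨j, hj, hj'⟩ := hrun s (hb s (List.mem_cons_of_mem _ hs)) ⟨0, hN⟩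
    obtain rfl : ⟨0, hN⟩ = j := Fin.ext ((hS s hs).symm.trans hj')
    exact hφ _ _ _ hj
  obtain ⟨j, hj, hj'⟩ := hrun w (hb w List.mem_cons_self) ⟨0, hN⟩
  have h1 : φ (FreeGroup.mk w) ⟨0, hN⟩ = ⟨0, hN⟩ := hstab h
  have h2 := hφ _ _ _ hj
  obtain rfl : j = ⟨0, hN⟩ := (φ _).injective (h2.trans h1.symm)
  exact hj'

/-- The table of an action on `N` points. -/
def tableOfHom {N : ℕ} (b : ℕ) (φ : FreeGroup ℕ →* Equiv.Perm (Fin N)) : List (List ℕ) :=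
  (List.range (2 * b)).map fun k => List.ofFn fun i : Fin N =>
    ((φ (FreeGroup.mk [(k / 2, decide (k % 2 = 1))]))⁻¹ i : ℕ)

theorem lookup_tableOfHom {N b : ℕ} (φ : FreeGroup ℕ →* Equiv.Perm (Fin N)) {x : ℕ × Bool}
    (hx : x.1 < b) (i : Fin N) :
    lookup (tableOfHom b φ) x i = (φ (FreeGroup.mk [x]))⁻¹ i := by
  obtain ⟨k, s⟩ := x
  have hk : k < b := hx
  have h1 : 2 * k + s.toNat < 2 * b := by cases s <;> simp <;> omega
  have h2 : (2 * k + s.toNat) / 2 = k := by cases s <;> simp; omega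
  have h3 : decide (s.toNat % 2 = 1) = s := by cases s <;> simp
  simp [lookup, tableOfHom, List.getD_eq_getElem?_getD, h1, h2, h3]

/-- The first letter of a word acts first in `actWord` but last under `φ`. This is why the table
stores inverse permutations. -/
theorem actWord_tableOfHom {N b : ℕ} (φ : FreeGroup ℕ →* Equiv.Perm (Fin N))
    {w : List (ℕ × Bool)} (hw : ∀ x ∈ w, x.1 < b) (i : Fin N) :
    actWord (tableOfHom b φ) w i = (φ (FreeGroup.mk w))⁻¹ i := by
  induction w generalizing i with
  | nil =>
    rw [← FreeGroup.one_eq_mk, _root_.map_one]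
    simp [actWord]
  | cons x w ih =>
    have e : FreeGroup.mk (x :: w) = FreeGroup.mk [x] * FreeGroup.mk w := rfl
    have : actWord (tableOfHom b φ) (x :: w) i =
      actWord (tableOfHom b φ) w (lookup (tableOfHom b φ) x i) := rfl
    rw [this, lookup_tableOfHom φ (hw x List.mem_cons_self),
      ih (fun y hy => hw y (List.mem_cons_of_mem _ hy)), e, _root_.map_mul, mul_inv_rev]
    rfl

theorem tableOfHom_mem {N b : ℕ} (φ : FreeGroup ℕ →* Equiv.Perm (Fin N)) :
    tableOfHom b φ ∈ listsUpTo (listsUpTo (List.range N) N) (2 * b) := by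
  refine mem_listsUpTo (by simp [tableOfHom]) fun r hr => ?_
  obtain ⟨k, _, rfl⟩ := List.mem_map.1 hr
  refine mem_listsUpTo (by simp) fun v hv => ?_
  obtain ⟨i, rfl⟩ := List.mem_ofFn.1 hv
  simp

theorem isPermTable_tableOfHom {N b : ℕ} (φ : FreeGroup ℕ →* Equiv.Perm (Fin N)) :
    IsPermTable b N (tableOfHom b φ) := by
  intro x hx v hv
  rw [mem_lettersBelow] at hx
  rw [List.mem_range] at hv
  have h1 := lookup_tableOfHom φ hx ⟨v, hv⟩
  rw [Fin.val_mk] at h1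
  rw [h1]
  refine ⟨Fin.is_lt _, ?_⟩
  have h2 : FreeGroup.mk [letterInv x] = (FreeGroup.mk [x])⁻¹ := rfl
  rw [lookup_tableOfHom φ (x := letterInv x) hx, h2, _root_.map_inv]
  simp

/-- Membership in a finitely generated subgroup is tested by finitely many actions. -/
theorem mem_wordSubgroup_iff {S : List (List (ℕ × Bool))} {w : List (ℕ × Bool)} :
    FreeGroup.mk w ∈ wordSubgroup S ↔
      FixesBase (letterBound (w :: S)) (vertexWords (w :: S)).length S w := by
  constructor
  · exact fixesBase_of_mem (by simp [vertexWords]) fun s hs x hx => lt_letterBound hs hx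
  · intro h
    by_contra hw
    -- The table of a separating action occurs among the enumerated ones, as its degree is exactly
    -- the number of points in the test.
    obtain ⟨φ, hS, hφ⟩ := exists_separating_hom hw
    have hact : ∀ s ∈ w :: S, actWord (tableOfHom (letterBound (w :: S)) φ) s 0 =
        ((φ (FreeGroup.mk s))⁻¹ (baseVertex (w :: S)) : ℕ) := fun s hs =>
      actWord_tableOfHom φ (fun x hx => lt_letterBound hs hx) (baseVertex (w :: S))
    have h1 := h _ (tableOfHom_mem φ) (isPermTable_tableOfHom φ) (by
      intro s hs
      rw [hact s (List.mem_cons_of_mem _ hs), Equiv.Perm.inv_eq_iff_eq.2 (hS s hs).symm]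
      rfl)
    rw [hact w List.mem_cons_self] at h1
    exact hφ (Equiv.Perm.inv_eq_iff_eq.1 (Fin.ext h1 : _ = baseVertex (w :: S))).symm

/-! ### Primitive recursiveness of the membership problem -/

section Primrec

variable {α β : Type*} [Primcodable α] [Primcodable β]

theorem primrecPred_ball {f : α → List β} {p : α → β → Prop} (hf : Primrec f)
    (hp : PrimrecRel p) : PrimrecPred fun a => ∀ b ∈ f a, p a b :=
  PrimrecRel.comp (PrimrecRel.forall_mem_list (R := fun b a => p a b) hp.swap) hf Primrec.id

theorem primrecPred_bex {f : α → List β} {p : α → β → Prop} (hf : Primrec f)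
    (hp : PrimrecRel p) : PrimrecPred fun a => ∃ b ∈ f a, p a b :=
  PrimrecRel.comp (PrimrecRel.exists_mem_list (R := fun b a => p a b) hp.swap) hf Primrec.id

theorem primrecPred_imp {p q : α → Prop} (hp : PrimrecPred p) (hq : PrimrecPred q) :
    PrimrecPred fun a => p a → q a :=
  (hp.not.or hq).of_eq fun _ => imp_iff_not_or.symm

theorem primrecPred_mem {f : α → β} {g : α → List β} (hf : Primrec f) (hg : Primrec g) :
    PrimrecPred fun a => f a ∈ g a :=
  (primrecPred_bex hg (p := fun a b => f a = b)
    (Primrec.eq.comp (hf.comp Primrec.fst) Primrec.snd)).of_eq fun a => by simp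

theorem primrec_filter {f : α → List β} {p : α → β → Prop} [∀ a, DecidablePred (p a)]
    (hf : Primrec f) (hp : PrimrecRel p) : Primrec fun a => (f a).filter fun b => p a b := by
  classical
  have := Primrec₂.comp (PrimrecRel.listFilter (R := fun b a => p a b) hp.swap) hf Primrec.id
  convert! this

theorem primrec_letterInv : Primrec (letterInv : α × Bool → α × Bool) :=
  Primrec.pair Primrec.fst (Primrec.not.comp Primrec.snd)

theorem primrec_invRev : Primrec (invRev : List (α × Bool) → List (α × Bool)) :=
  Primrec.list_reverse.comp (Primrec.list_map Primrec.id (primrec_letterInv.comp Primrec.snd))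

theorem primrec_vertexWords : Primrec (vertexWords : List (List α) → List (List α)) :=
  Primrec.list_cons.comp (Primrec.const []) (Primrec.list_flatMap Primrec.id
    (Primrec.list_map (Primrec.list_range.comp (Primrec.succ.comp
        (Primrec.list_length.comp Primrec.snd)))
      (Primrec.list_take.comp Primrec.snd (Primrec.snd.comp Primrec.fst))))

theorem primrec_listsUpTo : Primrec₂ (listsUpTo : List α → ℕ → List (List α)) := by
  refine Primrec.nat_rec (f := fun _ : List α => ([[]] : List (List α)))
    (g := fun L q => [] :: q.2.flatMap fun w => L.map fun a => a :: w) (Primrec.const [[]]) ?_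
  refine Primrec.list_cons.comp (Primrec.const []) (Primrec.list_flatMap
    (Primrec.snd.comp Primrec.snd) ?_)
  exact Primrec.list_map (Primrec.fst.comp Primrec.fst)
    (Primrec.list_cons.comp Primrec.snd (Primrec.snd.comp Primrec.fst))

theorem primrec_lettersBelow : Primrec lettersBelow :=
  Primrec.list_flatMap Primrec.list_range (Primrec.list_cons.comp
    (Primrec.pair Primrec.snd (Primrec.const true)) (Primrec.list_cons.comp
      (Primrec.pair Primrec.snd (Primrec.const false)) (Primrec.const [])))

theorem primrec_letterBound : Primrec letterBound :=
  Primrec.list_foldr (h := fun _ (q : (ℕ × Bool) × ℕ) => q.1.1 + q.2 + 1)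
    Primrec.list_flatten (Primrec.const 0)
    (Primrec.succ.comp (Primrec.nat_add.comp
      (Primrec.fst.comp (Primrec.fst.comp Primrec.snd)) (Primrec.snd.comp Primrec.snd)))

theorem primrec_lookup {f : α → List (List ℕ)} {g : α → ℕ × Bool} {h : α → ℕ}
    (hf : Primrec f) (hg : Primrec g) (hh : Primrec h) :
    Primrec fun a => lookup (f a) (g a) (h a) :=
  (Primrec.list_getD 0).comp ((Primrec.list_getD []).comp hf (Primrec.nat_add.comp
    (Primrec.nat_mul.comp (Primrec.const 2) (Primrec.fst.comp hg))
    ((Primrec.dom_finite Bool.toNat).comp (Primrec.snd.comp hg)))) hh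

theorem primrec_actWord {f : α → List (List ℕ)} {g : α → List (ℕ × Bool)} {h : α → ℕ}
    (hf : Primrec f) (hg : Primrec g) (hh : Primrec h) :
    Primrec fun a => actWord (f a) (g a) (h a) :=
  Primrec.list_foldl (h := fun a q => lookup (f a) q.2 q.1) hg hh (primrec_lookup (hf.comp Primrec.fst)
    (Primrec.snd.comp Primrec.snd) (Primrec.fst.comp Primrec.snd))

theorem primrecPred_isPermTable {f g : α → ℕ} {h : α → List (List ℕ)}
    (hf : Primrec f) (hg : Primrec g) (hh : Primrec h) :
    PrimrecPred fun a => IsPermTable (f a) (g a) (h a) := by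
  refine primrecPred_ball (primrec_lettersBelow.comp hf) (primrecPred_ball
    (Primrec.list_range.comp (hg.comp Primrec.fst)) ?_)
  have hl : Primrec fun q : (α × (ℕ × Bool)) × ℕ => lookup (h q.1.1) q.1.2 q.2 :=
    primrec_lookup (hh.comp (Primrec.fst.comp Primrec.fst)) (Primrec.snd.comp Primrec.fst)
      Primrec.snd
  exact (Primrec.nat_lt.comp hl (hg.comp (Primrec.fst.comp Primrec.fst))).and
    (Primrec.eq.comp (primrec_lookup (hh.comp (Primrec.fst.comp Primrec.fst))
      (primrec_letterInv.comp (Primrec.snd.comp Primrec.fst)) hl) Primrec.snd)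

/-- The membership problem of finitely generated subgroups of a free group is primitive
recursive. -/
theorem primrecPred_mem_wordSubgroup {f : α → List (List (ℕ × Bool))} {g : α → List (ℕ × Bool)}
    (hf : Primrec f) (hg : Primrec g) :
    PrimrecPred fun a => FreeGroup.mk (g a) ∈ wordSubgroup (f a) := by
  have hL : Primrec fun a => g a :: f a := Primrec.list_cons.comp hg hf
  have hb := primrec_letterBound.comp hL
  have hN := Primrec.list_length.comp (primrec_vertexWords.comp hL)
  refine PrimrecPred.of_eq (p := fun a => FixesBase (letterBound (g a :: f a))
    (vertexWords (g a :: f a)).length (f a) (g a)) ?_ fun a => mem_wordSubgroup_iff.symm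
  refine primrecPred_ball (primrec_listsUpTo.comp
    (primrec_listsUpTo.comp (Primrec.list_range.comp hN) hN)
    (Primrec.nat_mul.comp (Primrec.const 2) hb)) ?_
  refine primrecPred_imp (primrecPred_isPermTable (hb.comp Primrec.fst) (hN.comp Primrec.fst)
    Primrec.snd) (primrecPred_imp ?_ ?_)
  · exact primrecPred_ball (hf.comp Primrec.fst) (Primrec.eq.comp
      (primrec_actWord (Primrec.snd.comp Primrec.fst) Primrec.snd (Primrec.const 0))
      (Primrec.const 0))
  · exact Primrec.eq.comp
      (primrec_actWord Primrec.snd (hg.comp Primrec.fst) (Primrec.const 0)) (Primrec.const 0)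

end Primrec

/-! ### Generation and double cosets -/

section Generates

variable {S : List (List (ℕ × Bool))} {n : ℕ} {u v w : List (ℕ × Bool)}

/-- The words of `S` together with `u` generate all letters with index below `n`. -/
def GeneratesWith (n : ℕ) (S : List (List (ℕ × Bool))) (u : List (ℕ × Bool)) : Prop :=
  ∀ x ∈ lettersBelow n, FreeGroup.mk [x] ∈ wordSubgroup (u :: S)

theorem wordSubgroup_le_cons (S : List (List (ℕ × Bool))) (u : List (ℕ × Bool)) :
    wordSubgroup S ≤ wordSubgroup (u :: S) :=
  Subgroup.closure_mono fun _ ⟨s, hs, h⟩ => ⟨s, List.mem_cons_of_mem _ hs, h⟩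

theorem GeneratesWith.mk_mem (h : GeneratesWith n S u) (hw : ∀ x ∈ w, x.1 < n) :
    FreeGroup.mk w ∈ wordSubgroup (u :: S) := by
  induction w with
  | nil => exact Subgroup.one_mem _
  | cons x w ih =>
    have e : FreeGroup.mk (x :: w) = FreeGroup.mk [x] * FreeGroup.mk w := rfl
    rw [e]
    exact Subgroup.mul_mem _ (h x (by simpa using hw x List.mem_cons_self))
      (ih fun y hy => hw y (List.mem_cons_of_mem _ hy))

/-- Generation depends only on the double coset of the additional element. -/
theorem GeneratesWith.of_double_coset {a b : FreeGroup ℕ} (ha : a ∈ wordSubgroup S)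
    (hb : b ∈ wordSubgroup S) (huv : FreeGroup.mk u = a * FreeGroup.mk v * b)
    (h : GeneratesWith n S u) : GeneratesWith n S v := by
  have hle : wordSubgroup (u :: S) ≤ wordSubgroup (v :: S) := by
    rw [Subgroup.closure_le]
    rintro _ ⟨s, hs, rfl⟩
    rcases List.mem_cons.1 hs with rfl | hs
    · rw [huv]
      exact Subgroup.mul_mem _ (Subgroup.mul_mem _ (wordSubgroup_le_cons S v ha)
        (mk_mem_wordSubgroup List.mem_cons_self)) (wordSubgroup_le_cons S v hb)
    · exact mk_mem_wordSubgroup (List.mem_cons_of_mem _ hs)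
  exact fun x hx => hle (h x hx)

/-- With `p = h c` and `d q = h'` for `h`, `h'` in the subgroup, `p x q = h (c x d⁻¹) h'`. -/
theorem generatesWith_split_iff {p q c d : List (ℕ × Bool)} {x : ℕ × Bool}
    (hp : SameCoset (wordSubgroup S) p c) (hq : SameCoset (wordSubgroup S) (d ++ q) []) :
    GeneratesWith n S (p ++ x :: q) ↔ GeneratesWith n S (c ++ [x] ++ invRev d) := by
  rw [SameCoset.nil_right] at hq
  have e1 : FreeGroup.mk (p ++ x :: q) = FreeGroup.mk p * FreeGroup.mk [x] * FreeGroup.mk q := by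
    rw [mul_mk, mul_mk]; simp
  have e2 : FreeGroup.mk (c ++ [x] ++ invRev d) =
    FreeGroup.mk c * FreeGroup.mk [x] * (FreeGroup.mk d)⁻¹ := rfl
  have e3 : FreeGroup.mk (d ++ q) = FreeGroup.mk d * FreeGroup.mk q := rfl
  constructor
  · refine GeneratesWith.of_double_coset hp hq ?_
    rw [e1, e2, e3]; group
  · refine GeneratesWith.of_double_coset (Subgroup.inv_mem _ hp) (Subgroup.inv_mem _ hq) ?_
    rw [e1, e2, e3]; group

end Generates

/-! ### The automaton and its runs -/

/-- The states of the automaton: a tag and a word. -/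
abbrev TaggedWord : Type := ℕ × List (ℕ × Bool)

/-- The states: two copies of the vertices of the Schreier graph, with tags `0` and `1`, and
the letters, with tag `2`. -/
def states (n : ℕ) (S : List (List (ℕ × Bool))) : List TaggedWord :=
  (vertexWords S).map (fun v => (0, v)) ++ ((vertexWords S).map (fun v => (1, v)) ++
    (lettersBelow n).map fun x => (2, [x]))

/-- The transitions of the automaton: those of the Schreier graph in the two copies, a
passage from the first copy to the second one for letters that complete `S` to a
generating set, and a check for reducedness on the letters. -/
def Edge (n : ℕ) (S : List (List (ℕ × Bool))) (a : TaggedWord) (x : ℕ × Bool)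
    (b : TaggedWord) : Prop :=
  a ∈ states n S ∧ b ∈ states n S ∧
    ((a.1 = b.1 ∧ a.1 ≤ 1 ∧ FreeGroup.mk (a.2 ++ [x] ++ invRev b.2) ∈ wordSubgroup S) ∨
      (a.1 = 0 ∧ b.1 = 1 ∧ GeneratesWith n S (a.2 ++ [x] ++ invRev b.2)) ∨
      (a.1 = 2 ∧ b.1 = 2 ∧ b.2 = [x] ∧ a.2 ≠ [letterInv x]))

section Runs

variable {S : List (List (ℕ × Bool))} {n : ℕ}

theorem mem_states_of_le_one {t : ℕ} (ht : t ≤ 1) {v : List (ℕ × Bool)} :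
    (t, v) ∈ states n S ↔ v ∈ vertexWords S := by
  have : t = 0 ∨ t = 1 := by omega
  rcases this with rfl | rfl <;> simp [states]

theorem mem_states_two {v : List (ℕ × Bool)} :
    (2, v) ∈ states n S ↔ ∃ x : ℕ × Bool, x.1 < n ∧ v = [x] := by
  simp only [states, List.mem_append, List.mem_map, Prod.mk.injEq, mem_lettersBelow]
  constructor
  · rintro (⟨_, _, h, _⟩ | ⟨_, _, h, _⟩ | ⟨x, hx, _, h⟩)
    · omega
    · omega
    · exact ⟨x, hx, h.symm⟩
  · rintro ⟨x, hx, rfl⟩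
    exact Or.inr (Or.inr ⟨x, hx, trivial, rfl⟩)

theorem run_mem_states {a b : TaggedWord} {w : List (ℕ × Bool)} (ha : a ∈ states n S)
    (h : Run (Edge n S) a w b) : b ∈ states n S := by
  induction w generalizing a with
  | nil => exact run_nil.1 h ▸ ha
  | cons x w ih =>
    obtain ⟨c, hc, h⟩ := h
    exact ih hc.2.1 h

theorem tag_le_of_run {a b : TaggedWord} {w : List (ℕ × Bool)}
    (h : Run (Edge n S) a w b) : a.1 ≤ b.1 := by
  induction w generalizing a with
  | nil => exact (congrArg Prod.fst (run_nil.1 h)).le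
  | cons x w ih =>
    obtain ⟨c, ⟨-, -, hc⟩, h⟩ := h
    refine le_trans ?_ (ih h)
    rcases hc with hc | hc | hc <;> omega

theorem run_cons_level {t : ℕ} (ht : t ≤ 1) {a b w : List (ℕ × Bool)} {x : ℕ × Bool}
    (h : Run (Edge n S) (t, a) (x :: w) (t, b)) :
    ∃ c ∈ vertexWords S, SameCoset (wordSubgroup S) (a ++ [x]) c ∧
      Run (Edge n S) (t, c) w (t, b) := by
  obtain ⟨⟨t', c⟩, ⟨-, hcs, hc⟩, h⟩ := h
  have h1 : t' ≤ t := tag_le_of_run h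
  rcases hc with ⟨hc, -, hc'⟩ | ⟨hc, hc', -⟩ | ⟨hc, -⟩
  · obtain rfl : t = t' := hc
    exact ⟨c, (mem_states_of_le_one ht).1 hcs, hc', h⟩
  · simp only at hc hc'; omega
  · simp only at hc; omega

theorem sameCoset_of_run_level {t : ℕ} (ht : t ≤ 1) {a b w : List (ℕ × Bool)}
    (h : Run (Edge n S) (t, a) w (t, b)) : SameCoset (wordSubgroup S) (a ++ w) b := by
  induction w generalizing a with
  | nil =>
    obtain rfl : a = b := congrArg Prod.snd (run_nil.1 h)
    rw [List.append_nil]; exact SameCoset.refl _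
  | cons x w ih =>
    obtain ⟨c, -, hc, h⟩ := run_cons_level ht h
    simpa using (hc.append w).trans (ih h)

/-- The automaton may move to any word representing the right coset, not only the first one.
Replacing each state by its first representative turns a run within one copy into a path of the
Schreier graph. -/
theorem exists_schreier_run {t : ℕ} (ht : t ≤ 1) {a b w : List (ℕ × Bool)}
    (h : Run (Edge n S) (t, a) w (t, b)) {i : Fin (vertexWords S).length}
    (hi : IsFirstRep (wordSubgroup S) (vertexWords S) i)
    (hai : SameCoset (wordSubgroup S) a (vertexWords S)[i]) :
    ∃ j, Run (schreierGraph (wordSubgroup S) (vertexWords S)) i w j := by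
  induction w generalizing a i with
  | nil => exact ⟨i, rfl⟩
  | cons x w ih =>
    obtain ⟨c, hcV, hc, h⟩ := run_cons_level ht h
    obtain ⟨k, hk, hck⟩ := exists_isFirstRep (H := wordSubgroup S) hcV
    obtain ⟨j, hj⟩ := ih h hk hck
    exact ⟨j, k, ⟨hi, hk, (hai.symm.append [x]).trans (hc.trans hck)⟩, hj⟩

theorem run_of_schreier_run {t : ℕ} (ht : t ≤ 1) {w : List (ℕ × Bool)}
    {i j : Fin (vertexWords S).length}
    (h : Run (schreierGraph (wordSubgroup S) (vertexWords S)) i w j) :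
    Run (Edge n S) (t, (vertexWords S)[i]) w (t, (vertexWords S)[j]) :=
  h.map (fun i => (t, (vertexWords S)[i])) fun _ _ _ hE =>
    ⟨(mem_states_of_le_one ht).2 (List.getElem_mem _),
      (mem_states_of_le_one ht).2 (List.getElem_mem _), Or.inl ⟨rfl, ht, hE.2.2⟩⟩

theorem exists_passage {a b w : List (ℕ × Bool)} (h : Run (Edge n S) (0, a) w (1, b)) :
    ∃ p x q c d, w = p ++ x :: q ∧ Run (Edge n S) (0, a) p (0, c) ∧
      Run (Edge n S) (1, d) q (1, b) ∧ GeneratesWith n S (c ++ [x] ++ invRev d) := by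
  induction w generalizing a with
  | nil => simp at h
  | cons y w ih =>
    obtain ⟨⟨t, e⟩, hE, h⟩ := h
    obtain ⟨ha, he, hcase⟩ := hE
    rcases hcase with ⟨h1, -, h3⟩ | ⟨-, h2, h3⟩ | ⟨h1, -⟩
    · obtain rfl : 0 = t := h1
      obtain ⟨p, x, q, c, d, rfl, hp, hq, hg⟩ := ih h
      exact ⟨y :: p, x, q, c, d, rfl, ⟨(0, e), ⟨ha, he, Or.inl ⟨rfl, by simp, h3⟩⟩, hp⟩, hq, hg⟩
    · obtain rfl : t = 1 := h2
      exact ⟨[], y, w, a, e, rfl, rfl, h, h3⟩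
    · simp at h1

/-- A run crosses from the first copy to the second at one letter, and `generatesWith_split_iff`
moves generation between that crossing and `u`. If `u` completes `S` to a generating set, all
prefixes of `u` are generated, so `exists_split` supplies the crossing. It consumes a letter, hence
`u ≠ []`. -/
theorem run_passage_iff {u : List (ℕ × Bool)} (hu : IsReduced u) (hn : ∀ x ∈ u, x.1 < n) :
    Run (Edge n S) (0, []) u (1, []) ↔ u ≠ [] ∧ GeneratesWith n S u := by
  constructor
  · intro h
    obtain ⟨p, x, q, c, d, rfl, hp, hq, hg⟩ := exists_passage h
    refine ⟨by simp, (generatesWith_split_iff ?_ ?_).2 hg⟩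
    · simpa using sameCoset_of_run_level (Nat.zero_le 1) hp
    · exact sameCoset_of_run_level le_rfl hq
  · rintro ⟨hne, hg⟩
    have hS : ∀ s ∈ S, Run (schreierGraph (wordSubgroup S) (vertexWords S)) (baseVertex S) s
        (baseVertex S) := fun s hs => run_baseVertex_of_mem hs (mk_mem_wordSubgroup hs)
    obtain ⟨p, x, q, rfl, ⟨i, hi⟩, j, hj⟩ := isInverseGraph_schreierGraph.exists_split hS hu hne
      fun p hp => hg.mk_mem fun x hx => hn x (hp.subset hx)
    have hj' := isInverseGraph_schreierGraph.run_invRev hj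
    rw [invRev_invRev] at hj'
    have hip := sameCoset_of_run hi
    have hjq := sameCoset_of_run hj'
    rw [getElem_baseVertex] at hip hjq
    refine run_append.2 ⟨_, run_of_schreier_run (Nat.zero_le 1) hi, _, ?_,
      run_of_schreier_run le_rfl hj'⟩
    exact ⟨(mem_states_of_le_one (Nat.zero_le 1)).2 (List.getElem_mem _),
      (mem_states_of_le_one le_rfl).2 (List.getElem_mem _),
      Or.inr (Or.inl ⟨rfl, rfl, (generatesWith_split_iff hip hjq).1 hg⟩)⟩

theorem isReduced_of_run {a b : TaggedWord} (ha : a.1 = 2) {w : List (ℕ × Bool)}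
    (h : Run (Edge n S) a w b) : IsReduced w ∧ ∀ x ∈ w.head?, a.2 ≠ [letterInv x] := by
  induction w generalizing a with
  | nil => simp
  | cons x w ih =>
    obtain ⟨c, ⟨-, -, hc⟩, h⟩ := h
    obtain ⟨-, hc, hcx, hax⟩ : a.1 = 2 ∧ c.1 = 2 ∧ c.2 = [x] ∧ a.2 ≠ [letterInv x] := by
      rcases hc with hc | hc | hc
      · omega
      · omega
      · exact hc
    obtain ⟨hw, hh⟩ := ih hc h
    refine ⟨List.isChain_cons.2 ⟨fun y hy => ?_, hw⟩, by simpa using hax⟩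
    rw [reduced_pair_iff]
    rintro rfl
    exact hh _ hy (by simp [hcx])

theorem exists_run_of_isReduced {w : List (ℕ × Bool)} (hw : IsReduced w)
    (hn : ∀ x ∈ w, x.1 < n) {y : ℕ × Bool} (hy : y.1 < n) (h : ∀ x ∈ w.head?, y ≠ letterInv x) :
    ∃ b, Run (Edge n S) (2, [y]) w b := by
  induction w generalizing y with
  | nil => exact ⟨_, rfl⟩
  | cons x w ih =>
    obtain ⟨h1, h2⟩ := List.isChain_cons.1 hw
    have hx := hn x List.mem_cons_self
    obtain ⟨b, hb⟩ := ih h2 (fun z hz => hn z (List.mem_cons_of_mem _ hz)) hx fun z hz => by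
      have := h1 z hz
      rw [reduced_pair_iff] at this
      rintro rfl
      simp at this
    refine ⟨b, (2, [x]), ⟨mem_states_two.2 ⟨y, hy, rfl⟩, mem_states_two.2 ⟨x, hx, rfl⟩,
      Or.inr (Or.inr ⟨rfl, rfl, rfl, ?_⟩)⟩, hb⟩
    simpa using h x (by simp)

theorem exists_run_two_iff {w : List (ℕ × Bool)} (hne : w ≠ []) (hn : ∀ x ∈ w, x.1 < n) :
    (∃ a b, a ∈ states n S ∧ a.1 = 2 ∧ Run (Edge n S) a w b) ↔ IsReduced w := by
  constructor
  · rintro ⟨a, b, -, ha, h⟩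
    exact (isReduced_of_run ha h).1
  · intro hw
    obtain ⟨x, w, rfl⟩ := List.exists_cons_of_ne_nil hne
    have hx := hn x List.mem_cons_self
    -- A state with tag `2` remembers the previous letter. Starting from the first letter of the
    -- word itself is safe, since no letter is its own inverse.
    obtain ⟨b, hb⟩ := exists_run_of_isReduced (S := S) hw hn hx (by
      intro y hy
      obtain rfl : x = y := by simpa using hy
      exact (letterInv_ne x).symm)
    exact ⟨_, b, mem_states_two.2 ⟨x, hx, rfl⟩, rfl, hb⟩

theorem exists_run_zero_iff {w : List (ℕ × Bool)} :
    (∃ b, Run (Edge n S) (0, []) w (0, b)) ↔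
      ∃ j, Run (schreierGraph (wordSubgroup S) (vertexWords S)) (baseVertex S) w j := by
  constructor
  · rintro ⟨b, hb⟩
    exact exists_schreier_run (Nat.zero_le 1) hb (isFirstRep_baseVertex _) (SameCoset.refl _)
  · rintro ⟨j, hj⟩
    exact ⟨_, run_of_schreier_run (Nat.zero_le 1) hj⟩

/-- Indices that are not first representatives are isolated vertices of the Schreier graph; they
only raise the vertex count, which the criterion tolerates. -/
theorem exists_pow_mem_iff_run {p c : List (ℕ × Bool)} (hu : IsReduced (p ++ c ++ invRev p))
    (hc : IsReduced (c ++ c)) :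
    (∃ k, k ≠ 0 ∧ FreeGroup.mk (p ++ c ++ invRev p) ^ k ∈ wordSubgroup S) ↔
      ∃ b, Run (Edge n S) (0, []) (p ++ (List.replicate (vertexWords S).length c).flatten)
        (0, b) := by
  have hcyc : IsCyclicallyReduced c :=
    ⟨(List.isChain_append.1 hc).1, (List.isChain_append.1 hc).2.2⟩
  rw [exists_run_zero_iff, isInverseGraph_schreierGraph.exists_pow_mem_iff
    (fun s hs => run_baseVertex_of_mem hs (mk_mem_wordSubgroup hs))
    (fun w hw => (run_baseVertex_iff hw).1 rfl) hu hcyc, Fintype.card_fin]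

end Runs

/-! ### Relations induced by words on the states -/

/-- A finite relation between states. -/
abbrev StateRel : Type := List (TaggedWord × TaggedWord)

/-- All pairs of elements of a list. -/
def allPairs {X : Type*} (Q : List X) : List (X × X) := Q.flatMap fun a => Q.map fun b => (a, b)

theorem mem_allPairs {X : Type*} {Q : List X} {a b : X} :
    (a, b) ∈ allPairs Q ↔ a ∈ Q ∧ b ∈ Q := by
  simp [allPairs]

open Classical in
/-- The list of the pairs of elements of `Q` that satisfy `r`. -/
noncomputable def relList (Q : List TaggedWord) (r : TaggedWord → TaggedWord → Prop) : StateRel :=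
  (allPairs Q).filter fun ab => r ab.1 ab.2

theorem mem_relList {Q : List TaggedWord} {r : TaggedWord → TaggedWord → Prop}
    {a b : TaggedWord} : (a, b) ∈ relList Q r ↔ a ∈ Q ∧ b ∈ Q ∧ r a b := by
  simp [relList, mem_allPairs, and_assoc]

/-- Filtering one fixed list of pairs gives each relation a canonical list, so equivalent relations
become equal data and can serve as names of nonterminals. -/
theorem relList_congr {Q : List TaggedWord} {r r' : TaggedWord → TaggedWord → Prop}
    (h : ∀ a ∈ Q, ∀ b ∈ Q, (r a b ↔ r' a b)) : relList Q r = relList Q r' := by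
  classical
  refine List.filter_congr ?_
  rintro ⟨a, b⟩ hab
  obtain ⟨ha, hb⟩ := mem_allPairs.1 hab
  simp [h a ha b hb]

/-- Composition of relations. -/
noncomputable def compRel (Q : List TaggedWord) (m g : StateRel) : StateRel :=
  relList Q fun a b => ∃ c ∈ Q, (a, c) ∈ m ∧ (c, b) ∈ g

/-- The identity relation. -/
noncomputable def idRel (Q : List TaggedWord) : StateRel := relList Q fun a b => a = b

/-- Powers of a relation. -/
noncomputable def powRel (Q : List TaggedWord) (g : StateRel) (k : ℕ) : StateRel :=
  k.rec (idRel Q) fun _ m => compRel Q m g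

/-- A list that contains all relations of the form `relList Q r`. -/
def allRels (Q : List TaggedWord) : List StateRel :=
  listsUpTo (allPairs Q) (allPairs Q).length

theorem relList_mem_allRels (Q : List TaggedWord) (r : TaggedWord → TaggedWord → Prop) :
    relList Q r ∈ allRels Q := by
  classical
  exact mem_listsUpTo (List.length_filter_le _ _) fun a ha => List.mem_of_mem_filter ha

section RunRel

variable (n : ℕ) (S : List (List (ℕ × Bool)))

/-- The relation between states given by a letter. -/
noncomputable def letterRel (x : ℕ × Bool) : StateRel :=
  relList (states n S) fun a b => Edge n S a x b

/-- The relation between states given by a word. -/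
noncomputable def runRel (w : List (ℕ × Bool)) : StateRel :=
  relList (states n S) fun a b => Run (Edge n S) a w b

theorem runRel_nil : runRel n S [] = idRel (states n S) := rfl

theorem runRel_singleton (x : ℕ × Bool) : runRel n S [x] = letterRel n S x :=
  relList_congr fun _ _ _ _ => run_singleton

theorem compRel_runRel (u w : List (ℕ × Bool)) :
    compRel (states n S) (runRel n S u) (runRel n S w) = runRel n S (u ++ w) := by
  refine relList_congr fun a ha b hb => ?_
  rw [run_append]
  constructor
  · rintro ⟨c, -, h1, h2⟩
    exact ⟨c, (mem_relList.1 h1).2.2, (mem_relList.1 h2).2.2⟩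
  · rintro ⟨c, h1, h2⟩
    have hc := run_mem_states ha h1
    exact ⟨c, hc, mem_relList.2 ⟨ha, hc, h1⟩, mem_relList.2 ⟨hc, hb, h2⟩⟩

theorem powRel_runRel (w : List (ℕ × Bool)) (k : ℕ) :
    powRel (states n S) (runRel n S w) k = runRel n S (List.replicate k w).flatten := by
  induction k with
  | zero => rfl
  | succ k ih =>
    rw [List.replicate_succ', List.flatten_append, List.flatten_singleton, ← compRel_runRel, ← ih]
    rfl

/-- The acceptance condition: `m₁`, `g` and `m₂` are the relations of the three factors
of a word `p c p⁻¹`. -/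
def Accepts (m₁ g m₂ : StateRel) : Prop :=
  ((0, []), (1, [])) ∈ compRel (states n S) (compRel (states n S) m₁ g) m₂ ∧
  (∃ r ∈ compRel (states n S) (compRel (states n S) m₁ g) m₂, r.1.1 = 2) ∧
  (∃ r ∈ compRel (states n S) g g, r.1.1 = 2) ∧
  ¬ ∃ r ∈ compRel (states n S) m₁ (powRel (states n S) g (vertexWords S).length),
    r.1 = (0, []) ∧ r.2.1 = 0

variable {n S}

theorem exists_mem_runRel_two {w : List (ℕ × Bool)} :
    (∃ r ∈ runRel n S w, r.1.1 = 2) ↔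
      ∃ a b, a ∈ states n S ∧ a.1 = 2 ∧ Run (Edge n S) a w b := by
  constructor
  · rintro ⟨⟨a, b⟩, hr, h2⟩
    obtain ⟨ha, -, h⟩ := mem_relList.1 hr
    exact ⟨a, b, ha, h2, h⟩
  · rintro ⟨a, b, ha, h2, h⟩
    exact ⟨(a, b), mem_relList.2 ⟨ha, run_mem_states ha h, h⟩, h2⟩

theorem base_mem_states {t : ℕ} (ht : t ≤ 1) : (t, []) ∈ states n S :=
  (mem_states_of_le_one ht).2 List.mem_cons_self

theorem exists_mem_runRel_zero {w : List (ℕ × Bool)} :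
    (∃ r ∈ runRel n S w, r.1 = (0, []) ∧ r.2.1 = 0) ↔
      ∃ b, Run (Edge n S) (0, []) w (0, b) := by
  constructor
  · rintro ⟨⟨a, ⟨t, b⟩⟩, hr, h1, h2⟩
    obtain rfl : a = (0, []) := h1
    obtain rfl : t = 0 := h2
    exact ⟨b, (mem_relList.1 hr).2.2⟩
  · rintro ⟨b, h⟩
    have h0 := base_mem_states (n := n) (S := S) (Nat.zero_le 1)
    exact ⟨((0, []), (0, b)), mem_relList.2 ⟨h0, run_mem_states h0 h, h⟩, rfl, rfl⟩

/-- The clauses of `Accepts` test, in order, the passage for `p c p⁻¹`, reducedness of `p c p⁻¹`,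
reducedness of `c c`, and unreadability of `p c ^ N`. Each of these is a run of a concatenated word,
so composing the relations of the factors decides it. -/
theorem accepts_iff {p c : List (ℕ × Bool)} (hp : ∀ x ∈ p, x.1 < n) (hc : ∀ x ∈ c, x.1 < n) :
    Accepts n S (runRel n S p) (runRel n S c) (runRel n S (invRev p)) ↔
      p ++ c ++ invRev p ≠ [] ∧ IsReduced (p ++ c ++ invRev p) ∧ IsReduced (c ++ c) ∧
      GeneratesWith n S (p ++ c ++ invRev p) ∧
      ∀ k, k ≠ 0 → FreeGroup.mk (p ++ c ++ invRev p) ^ k ∉ wordSubgroup S := by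
  have hu : ∀ x ∈ p ++ c ++ invRev p, x.1 < n := by
    intro x hx
    simp only [List.mem_append] at hx
    rcases hx with (hx | hx) | hx
    · exact hp x hx
    · exact hc x hx
    · simp only [invRev, List.mem_reverse, List.mem_map] at hx
      obtain ⟨y, hy, rfl⟩ := hx
      exact hp y hy
  have hcc : ∀ x ∈ c ++ c, x.1 < n := by
    intro x hx
    rcases List.mem_append.1 hx with hx | hx <;> exact hc x hx
  unfold Accepts
  rw [powRel_runRel, compRel_runRel, compRel_runRel, compRel_runRel, compRel_runRel,
    exists_mem_runRel_two, exists_mem_runRel_two, exists_mem_runRel_zero]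
  have h01 : ((0, []), (1, [])) ∈ runRel n S (p ++ c ++ invRev p) ↔
      Run (Edge n S) (0, []) (p ++ c ++ invRev p) (1, []) :=
    ⟨fun h => (mem_relList.1 h).2.2, fun h => mem_relList.2
      ⟨base_mem_states (Nat.zero_le 1), base_mem_states le_rfl, h⟩⟩
  rw [h01]
  constructor
  · rintro ⟨h1, ⟨a, b, -, h2, h2'⟩, ⟨a', b', -, h3, h3'⟩, h4⟩
    have hred := (isReduced_of_run h2 h2').1
    have hcred := (isReduced_of_run h3 h3').1
    obtain ⟨hne, hg⟩ := (run_passage_iff hred hu).1 h1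
    refine ⟨hne, hred, hcred, hg, fun k hk hmem => h4 ?_⟩
    exact (exists_pow_mem_iff_run hred hcred).1 ⟨k, hk, hmem⟩
  · rintro ⟨hne, hred, hcred, hg, hk⟩
    refine ⟨(run_passage_iff hred hu).2 ⟨hne, hg⟩, (exists_run_two_iff hne hu).2 hred,
      (exists_run_two_iff ?_ hcc).2 hcred, fun h => ?_⟩
    -- The tag `2` criterion needs a nonempty word. If `c` were empty, `p p⁻¹` would be a nonempty
    -- reduced word representing `1`.
    · intro hc0
      obtain rfl : c = [] := by simpa using hc0
      have h1 : FreeGroup.mk (p ++ [] ++ invRev p) = FreeGroup.mk [] := by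
        rw [List.append_nil, ← mul_mk, ← inv_mk, mul_inv_cancel]; rfl
      have h2 := reduce.sound h1
      rw [hred.reduce_eq] at h2
      exact hne h2
    · obtain ⟨k, hk0, hmem⟩ := (exists_pow_mem_iff_run hred hcred).2 h
      exact hk k hk0 hmem

end RunRel

/-! ### Linear grammars as context-free grammars -/

/-- A rule of a linear grammar: `(A, none)` stands for `A → ε` and `(A, some (x, B, y))` for
`A → x B y`. -/
abbrev LinearRule (T N : Type*) : Type _ := N × Option (List T × N × List T)

/-- The production described by a linear rule. -/
def LinearRule.toProduction {T N : Type*} [Encodable N] (r : LinearRule T N) :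
    ℕ × List (T ⊕ ℕ) :=
  (Encodable.encode r.1, r.2.elim [] fun q =>
    q.1.map Sum.inl ++ Sum.inr (Encodable.encode q.2.1) :: q.2.2.map Sum.inl)

/-- The words derived from a nonterminal by a list of linear rules. -/
inductive LinearDerives {T N : Type*} (R : List (LinearRule T N)) : N → List T → Prop
  | final {A : N} : (A, none) ∈ R → LinearDerives R A []
  | step {A B : N} {x y w : List T} : (A, some (x, B, y)) ∈ R → LinearDerives R B w →
      LinearDerives R A (x ++ w ++ y)

section LinearGrammar

variable {T N : Type*}

/-- The context-free rule described by a linear rule, for a naming `enc` of the nonterminals. -/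
def LinearRule.toRule {N' : Type*} (enc : N → N') (r : LinearRule T N) : ContextFreeRule T N' :=
  ⟨enc r.1, r.2.elim [] fun q => q.1.map Symbol.terminal ++
    Symbol.nonterminal (enc q.2.1) :: q.2.2.map Symbol.terminal⟩

theorem terminal_of_derives {g : ContextFreeGrammar T} {u : List T} {v : List (Symbol T g.NT)}
    (h : g.Derives (u.map Symbol.terminal) v) : v = u.map Symbol.terminal := by
  rcases h.eq_or_head with h | ⟨v', ⟨r, -, hr⟩, -⟩
  · exact h.symm
  · simpa using hr.nonterminal_input_mem

theorem rewrites_linear {N' : Type*} {r : ContextFreeRule T N'} {x y : List T} {A : N'}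
    {v : List (Symbol T N')}
    (h : r.Rewrites (x.map Symbol.terminal ++ Symbol.nonterminal A :: y.map Symbol.terminal) v) :
    r.input = A ∧ v = x.map Symbol.terminal ++ r.output ++ y.map Symbol.terminal := by
  induction x generalizing v with
  | nil =>
    cases h with
    | head => simp
    | cons _ h => simpa using h.nonterminal_input_mem
  | cons t x ih =>
    cases h with
    | cons _ h =>
      obtain ⟨h1, rfl⟩ := ih h
      simp [h1]

section

variable {g : ContextFreeGrammar T} {enc : N → g.NT} {R : List (LinearRule T N)}

theorem derives_of_linearDerives (hR : ∀ q ∈ R, q.toRule enc ∈ g.rules) {A : N} {w : List T}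
    (h : LinearDerives R A w) : g.Derives [Symbol.nonterminal (enc A)] (w.map Symbol.terminal) := by
  induction h with
  | final h =>
    exact ContextFreeGrammar.Produces.single
      ⟨_, hR _ h, ContextFreeRule.Rewrites.input_output⟩
  | @step A B x y w h _ ih =>
    have h1 : g.Produces [Symbol.nonterminal (enc A)] (x.map Symbol.terminal ++
        Symbol.nonterminal (enc B) :: y.map Symbol.terminal) :=
      ⟨_, hR _ h, ContextFreeRule.Rewrites.input_output⟩
    refine h1.trans_derives ?_
    have := (ih.append_left (x.map Symbol.terminal)).append_right (y.map Symbol.terminal)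
    simpa using this

/-- Until the final rule is used, every sentential form has exactly one nonterminal, flanked by
terminal words; afterwards no rule applies. Injectivity of `enc` identifies the linear rule behind
each rewriting step. -/
theorem linearDerives_of_derives (henc : Function.Injective enc)
    (hR : ∀ r ∈ g.rules, ∃ q ∈ R, q.toRule enc = r) {v : List (Symbol T g.NT)} {w : List T}
    (h : g.Derives v (w.map Symbol.terminal)) (x y : List T) (A : N)
    (hv : v = x.map Symbol.terminal ++ Symbol.nonterminal (enc A) :: y.map Symbol.terminal) :
    ∃ w', w = x ++ w' ++ y ∧ LinearDerives R A w' := by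
  induction h using Relation.ReflTransGen.head_induction_on generalizing x y A with
  | refl =>
    have : Symbol.nonterminal (enc A) ∈ (w.map Symbol.terminal : List (Symbol T g.NT)) := by
      rw [hv]; simp
    simp at this
  | head hp hd ih =>
    subst hv
    obtain ⟨r, hr, hrw⟩ := hp
    obtain ⟨⟨A', q⟩, hq, rfl⟩ := hR r hr
    obtain ⟨hA, rfl⟩ := rewrites_linear hrw
    obtain rfl : A' = A := henc hA
    match q with
    | none =>
      have hd' : g.Derives ((x ++ y).map Symbol.terminal) (w.map Symbol.terminal) := by
        simpa [LinearRule.toRule] using hd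
      refine ⟨[], ?_, .final hq⟩
      have hinj : Function.Injective (Symbol.terminal : T → Symbol T g.NT) :=
        fun a b h => by simpa using h
      simpa using List.map_injective_iff.2 hinj (terminal_of_derives hd')
    | some (x', B, y') =>
      obtain ⟨w', rfl, hw'⟩ := ih (x ++ x') (y' ++ y) B (by simp [LinearRule.toRule])
      exact ⟨x' ++ w' ++ y', by simp, .step hq hw'⟩

end

variable [DecidableEq T] [Encodable N]

/-- The grammar code given by an initial nonterminal and a list of linear rules. -/
def linearCode (s : N) (R : List (LinearRule T N)) : GrammarCode T :=
  (Encodable.encode s, R.map LinearRule.toProduction)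

theorem mem_rules_linearCode {s : N} {R : List (LinearRule T N)} {r : ContextFreeRule T ℕ} :
    r ∈ (GrammarCode.toGrammar (linearCode s R)).rules ↔
      ∃ q ∈ R, q.toRule Encodable.encode = r := by
  have hq : ∀ q : LinearRule T N,
      GrammarCode.toRule q.toProduction = q.toRule Encodable.encode := by
    rintro ⟨A, _ | ⟨x, B, y⟩⟩
    · rfl
    · simp [GrammarCode.toRule, LinearRule.toProduction, LinearRule.toRule, Function.comp_def]
  change r ∈ ((linearCode s R).2.map GrammarCode.toRule).toFinset ↔ _
  rw [List.mem_toFinset, linearCode, List.map_map, List.mem_map]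
  simp only [Function.comp_apply, hq]

theorem mem_language_linearCode {s : N} {R : List (LinearRule T N)} {w : List T} :
    w ∈ (GrammarCode.toGrammar (linearCode s R)).language ↔ LinearDerives R s w := by
  rw [ContextFreeGrammar.mem_language_iff]
  constructor
  · intro h
    obtain ⟨w', rfl, hw'⟩ := linearDerives_of_derives (enc := (Encodable.encode : N → ℕ))
      Encodable.encode_injective (fun r hr => mem_rules_linearCode.1 hr) h [] [] s rfl
    simpa using hw'
  · exact derives_of_linearDerives (g := GrammarCode.toGrammar (linearCode s R))
      (enc := (Encodable.encode : N → ℕ)) fun q hq => mem_rules_linearCode.2 ⟨q, hq, rfl⟩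

end LinearGrammar

/-! ### The grammar of direct cocycles -/

/-- The nonterminals of the grammar of direct cocycles: an initial one, those that derive a
word `p c p⁻¹` between two given contexts, and those that derive the rest of the
factor `c`. -/
abbrev NonTerm : Type := Option (StateRel × StateRel × Option StateRel)

section CocycleGrammar

variable {α : Type*} (e : α → ℕ) (L : List (α × Bool)) (n : ℕ) (S : List (List (ℕ × Bool)))

/-- The letter obtained by numbering the generators by `e`. -/
def mapLetter (x : α × Bool) : ℕ × Bool := (e x.1, x.2)

open Classical in
/-- The rules for the initial nonterminal. -/
noncomputable def startRules : List (LinearRule (α × Bool) NonTerm) :=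
  (none, some ([], some (idRel (states n S), idRel (states n S), none), [])) ::
    if GeneratesWith n S [] then [(none, none)] else []

/-- The rules for the factors `p` and `p⁻¹`. -/
noncomputable def outerRules : List (LinearRule (α × Bool) NonTerm) :=
  (allRels (states n S)).flatMap fun m₁ => (allRels (states n S)).flatMap fun m₂ =>
    (some (m₁, m₂, none), some ([], some (m₁, m₂, some (idRel (states n S))), [])) ::
      L.map fun x => (some (m₁, m₂, none),
        some ([x], some (compRel (states n S) m₁ (letterRel n S (mapLetter e x)),
          compRel (states n S) (letterRel n S (letterInv (mapLetter e x))) m₂, none),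
          [letterInv x]))

open Classical in
/-- The rules for the factor `c`. -/
noncomputable def innerRules : List (LinearRule (α × Bool) NonTerm) :=
  (allRels (states n S)).flatMap fun m₁ => (allRels (states n S)).flatMap fun m₂ =>
    (allRels (states n S)).flatMap fun g =>
      (if Accepts n S m₁ g m₂ then [(some (m₁, m₂, some g), none)] else []) ++
      L.map fun x => (some (m₁, m₂, some g),
        some ([x], some (m₁, m₂, some (compRel (states n S) g (letterRel n S (mapLetter e x)))),
          []))

/-- The rules of the grammar of direct cocycles. -/
noncomputable def cocycleRules : List (LinearRule (α × Bool) NonTerm) :=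
  startRules n S ++ (outerRules e L n S ++ innerRules e L n S)

variable {e L n S}

theorem mem_cocycleRules_none {q} :
    (none, q) ∈ cocycleRules e L n S ↔
      q = some ([], some (runRel n S [], runRel n S [], none), []) ∨
        (GeneratesWith n S [] ∧ q = none) := by
  by_cases h : GeneratesWith n S [] <;>
  simp [cocycleRules, startRules, outerRules, innerRules, runRel_nil, h]

theorem mem_cocycleRules_outer {m₁ m₂ : StateRel} {q} :
    (some (m₁, m₂, none), q) ∈ cocycleRules e L n S ↔
      m₁ ∈ allRels (states n S) ∧ m₂ ∈ allRels (states n S) ∧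
      (q = some ([], some (m₁, m₂, some (runRel n S [])), []) ∨ ∃ x ∈ L,
        q = some ([x], some (compRel (states n S) m₁ (runRel n S [mapLetter e x]),
          compRel (states n S) (runRel n S [letterInv (mapLetter e x)]) m₂, none),
          [letterInv x])) := by
  have h : (some (m₁, m₂, none), q) ∈ cocycleRules e L n S ↔
      (some (m₁, m₂, none), q) ∈ outerRules e L n S := by
    simp only [cocycleRules, startRules, innerRules, List.mem_append, List.mem_flatMap,
      List.mem_map]
    constructor
    · rintro (h | h | h)
      · split_ifs at h <;> simp at h
      · exact h
      · obtain ⟨a, -, b, -, c, -, h | ⟨x, -, h⟩⟩ := h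
        · split_ifs at h <;> simp at h
        · simp at h
    · exact fun h => Or.inr (Or.inl h)
  rw [h]
  simp only [outerRules, List.mem_flatMap, List.mem_cons, List.mem_map, runRel_nil,
    runRel_singleton]
  constructor
  · rintro ⟨a, ha, b, hb, h | ⟨x, hx, h⟩⟩
    · simp only [Prod.mk.injEq, Option.some.injEq, and_true] at h
      obtain ⟨⟨rfl, rfl⟩, rfl⟩ := h
      exact ⟨ha, hb, Or.inl rfl⟩
    · simp only [Prod.mk.injEq, Option.some.injEq, and_true] at h
      obtain ⟨⟨rfl, rfl⟩, rfl⟩ := h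
      exact ⟨ha, hb, Or.inr ⟨x, hx, rfl⟩⟩
  · rintro ⟨ha, hb, rfl | ⟨x, hx, rfl⟩⟩
    · exact ⟨m₁, ha, m₂, hb, Or.inl rfl⟩
    · exact ⟨m₁, ha, m₂, hb, Or.inr ⟨x, hx, rfl⟩⟩

theorem mem_cocycleRules_inner {m₁ m₂ g : StateRel} {q} :
    (some (m₁, m₂, some g), q) ∈ cocycleRules e L n S ↔
      m₁ ∈ allRels (states n S) ∧ m₂ ∈ allRels (states n S) ∧ g ∈ allRels (states n S) ∧
      ((Accepts n S m₁ g m₂ ∧ q = none) ∨ ∃ x ∈ L,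
        q = some ([x], some (m₁, m₂, some (compRel (states n S) g
          (runRel n S [mapLetter e x]))), [])) := by
  have h : (some (m₁, m₂, some g), q) ∈ cocycleRules e L n S ↔
      (some (m₁, m₂, some g), q) ∈ innerRules e L n S := by
    simp only [cocycleRules, startRules, outerRules, List.mem_append, List.mem_flatMap,
      List.mem_cons, List.mem_map]
    constructor
    · rintro ((h | h) | ⟨a, -, b, -, h | ⟨x, -, h⟩⟩ | h)
      · simp at h
      · split_ifs at h <;> simp at h
      · simp at h
      · simp at h
      · exact h
    · exact fun h => Or.inr (Or.inr h)
  rw [h]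
  simp only [innerRules, List.mem_flatMap, List.mem_append, List.mem_map, runRel_singleton]
  constructor
  · rintro ⟨a, ha, b, hb, c, hc, h | ⟨x, hx, h⟩⟩
    · split_ifs at h with hacc
      · simp only [List.mem_singleton, Prod.mk.injEq, Option.some.injEq] at h
        obtain ⟨⟨rfl, rfl, rfl⟩, rfl⟩ := h
        exact ⟨ha, hb, hc, Or.inl ⟨hacc, rfl⟩⟩
      · simp at h
    · simp only [Prod.mk.injEq, Option.some.injEq] at h
      obtain ⟨⟨rfl, rfl, rfl⟩, rfl⟩ := h
      exact ⟨ha, hb, hc, Or.inr ⟨x, hx, rfl⟩⟩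
  · rintro ⟨ha, hb, hc, ⟨hacc, rfl⟩ | ⟨x, hx, rfl⟩⟩
    · exact ⟨m₁, ha, m₂, hb, g, hc, Or.inl (by simp [hacc])⟩
    · exact ⟨m₁, ha, m₂, hb, g, hc, Or.inr ⟨x, hx, rfl⟩⟩

theorem runRel_mem_allRels (w : List (ℕ × Bool)) : runRel n S w ∈ allRels (states n S) :=
  relList_mem_allRels _ _

/-- The third component holds the relation of the part `c` of the inner factor produced so far. Each
letter extends it on the right, and acceptance is checked on stopping. -/
theorem linearDerives_inner_iff (hL : ∀ x, x ∈ L) {m₁ m₂ : StateRel}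
    (h₁ : m₁ ∈ allRels (states n S)) (h₂ : m₂ ∈ allRels (states n S)) {c : List (ℕ × Bool)}
    {w : List (α × Bool)} :
    LinearDerives (cocycleRules e L n S) (some (m₁, m₂, some (runRel n S c))) w ↔
      Accepts n S m₁ (runRel n S (c ++ w.map (mapLetter e))) m₂ := by
  constructor
  · intro h
    generalize hA : some (m₁, m₂, some (runRel n S c)) = A at h
    induction h generalizing c with
    | final h =>
      subst hA
      obtain ⟨-, -, -, ⟨h, -⟩ | ⟨x, -, h⟩⟩ := mem_cocycleRules_inner.1 h
      · simpa using h
      · simp at h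
    | step h _ ih =>
      subst hA
      obtain ⟨-, -, -, ⟨-, h⟩ | ⟨x, -, h⟩⟩ := mem_cocycleRules_inner.1 h
      · simp at h
      · rw [compRel_runRel] at h
        simp only [Option.some.injEq, Prod.mk.injEq] at h
        obtain ⟨rfl, rfl, rfl⟩ := h
        simpa using ih rfl
  · intro h
    induction w generalizing c with
    | nil =>
      exact .final (mem_cocycleRules_inner.2 ⟨h₁, h₂, runRel_mem_allRels _,
        Or.inl ⟨by simpa using h, rfl⟩⟩)
    | cons x w ih =>
      have := LinearDerives.step (mem_cocycleRules_inner.2 ⟨h₁, h₂, runRel_mem_allRels c,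
        Or.inr ⟨x, hL x, rfl⟩⟩) (by rw [compRel_runRel]; exact ih (by simpa using h))
      simpa using this

theorem invRev_map_mapLetter (w : List (α × Bool)) :
    (invRev w).map (mapLetter e) = invRev (w.map (mapLetter e)) := by
  simp [invRev, mapLetter]

/-- Producing `x` on the left and its inverse on the right replaces the context `p` by `p x`, which
keeps the two recorded relations those of a word and its inverse. The remaining rule switches to the
inner factor. -/
theorem linearDerives_outer_iff (hL : ∀ x, x ∈ L) {p : List (ℕ × Bool)} {w : List (α × Bool)} :
    LinearDerives (cocycleRules e L n S) (some (runRel n S p, runRel n S (invRev p), none)) w ↔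
      ∃ q c, w = q ++ c ++ invRev q ∧ Accepts n S (runRel n S (p ++ q.map (mapLetter e)))
        (runRel n S (c.map (mapLetter e))) (runRel n S (invRev (p ++ q.map (mapLetter e)))) := by
  have hcomp : ∀ (p : List (ℕ × Bool)) (x : ℕ × Bool),
      compRel (states n S) (runRel n S [letterInv x]) (runRel n S (invRev p)) =
        runRel n S (invRev (p ++ [x])) := by
    intro p x
    rw [compRel_runRel, invRev_append]; rfl
  constructor
  · intro h
    generalize hA : some (runRel n S p, runRel n S (invRev p), none) = A at h
    induction h generalizing p with
    | final h =>
      subst hA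
      obtain ⟨-, -, h | ⟨x, -, h⟩⟩ := mem_cocycleRules_outer.1 h <;> simp at h
    | step h hd ih =>
      subst hA
      obtain ⟨-, -, h | ⟨x, -, h⟩⟩ := mem_cocycleRules_outer.1 h
      · simp only [Option.some.injEq, Prod.mk.injEq] at h
        obtain ⟨rfl, rfl, rfl⟩ := h
        rw [linearDerives_inner_iff hL (runRel_mem_allRels _) (runRel_mem_allRels _)] at hd
        exact ⟨[], _, by simp; rfl, by simpa using hd⟩
      · rw [hcomp, compRel_runRel] at h
        simp only [Option.some.injEq, Prod.mk.injEq] at h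
        obtain ⟨rfl, rfl, rfl⟩ := h
        obtain ⟨q, c, rfl, h⟩ := ih rfl
        refine ⟨x :: q, c, by simp [invRev_cons_eq], by simpa using h⟩
  · rintro ⟨q, c, rfl, h⟩
    induction q generalizing p with
    | nil =>
      have := LinearDerives.step (mem_cocycleRules_outer.2 ⟨runRel_mem_allRels p,
        runRel_mem_allRels (invRev p), Or.inl rfl⟩)
        ((linearDerives_inner_iff (e := e) hL (runRel_mem_allRels _) (runRel_mem_allRels _)
          (w := c)).2 (by simpa using h))
      simpa using this
    | cons x q ih =>
      have := LinearDerives.step (mem_cocycleRules_outer.2 ⟨runRel_mem_allRels p,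
        runRel_mem_allRels (invRev p), Or.inr ⟨x, hL x, rfl⟩⟩)
        (by rw [hcomp, compRel_runRel]; exact ih (by simpa using h))
      simpa [invRev_cons_eq] using this

theorem linearDerives_start_iff (hL : ∀ x, x ∈ L) {w : List (α × Bool)} :
    LinearDerives (cocycleRules e L n S) none w ↔
      (w = [] ∧ GeneratesWith n S []) ∨
      ∃ p c, w = p ++ c ++ invRev p ∧ Accepts n S (runRel n S (p.map (mapLetter e)))
        (runRel n S (c.map (mapLetter e))) (runRel n S (invRev (p.map (mapLetter e)))) := by
  have houter := linearDerives_outer_iff (e := e) (n := n) (S := S) hL (p := []) (w := w)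
  simp only [List.nil_append, invRev_empty] at houter
  rw [← houter]
  constructor
  · intro h
    cases h with
    | final h =>
      rcases mem_cocycleRules_none.1 h with h | ⟨h, -⟩
      · simp at h
      · exact Or.inl ⟨rfl, h⟩
    | step h hd =>
      rcases mem_cocycleRules_none.1 h with h | ⟨-, h⟩
      · simp only [Option.some.injEq, Prod.mk.injEq] at h
        obtain ⟨rfl, rfl, rfl⟩ := h
        exact Or.inr (by simpa using hd)
      · simp at h
  · rintro (⟨rfl, h⟩ | h)
    · exact .final (mem_cocycleRules_none.2 (Or.inr ⟨h, rfl⟩))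
    · simpa using LinearDerives.step (mem_cocycleRules_none.2 (Or.inl rfl)) h

/-- Cyclic reduction writes any reduced word as `p c p⁻¹` with `c` cyclically reduced, which is the
form the grammar guesses. The empty word meets the power condition trivially and comes from the
separate initial rule. -/
theorem linearDerives_start_iff_of_lt (hL : ∀ x, x ∈ L) (he : ∀ a, e a < n)
    (hinj : Function.Injective e) [DecidableEq α] {w : List (α × Bool)} :
    LinearDerives (cocycleRules e L n S) none w ↔
      IsReduced w ∧ GeneratesWith n S (w.map (mapLetter e)) ∧
      ∀ k, k ≠ 0 → FreeGroup.mk (w.map (mapLetter e)) ^ k ∈ wordSubgroup S → w = [] := by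
  have hlt : ∀ w : List (α × Bool), ∀ x ∈ w.map (mapLetter e), x.1 < n := by
    intro w x hx
    obtain ⟨y, -, rfl⟩ := List.mem_map.1 hx
    exact he _
  have hred : ∀ w : List (α × Bool), IsReduced (w.map (mapLetter e)) ↔ IsReduced w := by
    intro w
    simp [FreeGroup.IsReduced, List.isChain_map, mapLetter, hinj.eq_iff]
  have hmap : ∀ p c : List (α × Bool), p.map (mapLetter e) ++ c.map (mapLetter e) ++
      invRev (p.map (mapLetter e)) = (p ++ c ++ invRev p).map (mapLetter e) := by
    intro p c
    rw [List.map_append, List.map_append, invRev_map_mapLetter]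
  rw [linearDerives_start_iff hL]
  constructor
  · rintro (⟨rfl, h⟩ | ⟨p, c, rfl, h⟩)
    · exact ⟨IsReduced.nil, h, fun _ _ _ => rfl⟩
    · obtain ⟨-, h1, -, h2, h3⟩ := (accepts_iff (hlt p) (hlt c)).1 h
      rw [hmap] at h1 h2 h3
      exact ⟨(hred _).1 h1, h2, fun k hk hmem => absurd hmem (h3 k hk)⟩
  · rintro ⟨h1, h2, h3⟩
    by_cases hw : w = []
    · subst hw
      exact Or.inl ⟨rfl, h2⟩
    right
    have hc := reduceCyclically.isCyclicallyReduced h1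
    refine ⟨reduceCyclically.conjugator w, reduceCyclically w,
      (reduceCyclically.conj_conjugator_reduceCyclically w).symm, ?_⟩
    rw [accepts_iff (hlt _) (hlt _), hmap, ← List.map_append,
      reduceCyclically.conj_conjugator_reduceCyclically, hred, hred]
    exact ⟨by simpa using hw, h1, List.isChain_append.2 ⟨hc.1, hc.1, hc.2⟩, h2,
      fun k hk hmem => hw (h3 k hk hmem)⟩

end CocycleGrammar

/-! ### Primitive recursiveness of the grammar -/

section Primrec

set_option synthInstance.maxSize 2000

variable {α β : Type*} [Primcodable α] [Primcodable β]

theorem primrecPred_generatesWith {n : α → ℕ} {S : α → List (List (ℕ × Bool))}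
    {u : α → List (ℕ × Bool)} (hn : Primrec n) (hS : Primrec S) (hu : Primrec u) :
    PrimrecPred fun a => GeneratesWith (n a) (S a) (u a) :=
  primrecPred_ball (primrec_lettersBelow.comp hn) (primrecPred_mem_wordSubgroup
    ((Primrec.list_cons.comp hu hS).comp Primrec.fst)
    (Primrec.list_cons.comp Primrec.snd (Primrec.const [])))

theorem primrec_states {n : α → ℕ} {S : α → List (List (ℕ × Bool))} (hn : Primrec n)
    (hS : Primrec S) : Primrec fun a => states (n a) (S a) := by
  have hV := primrec_vertexWords.comp hS
  exact Primrec.list_append.comp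
    (Primrec.list_map hV (Primrec.pair (Primrec.const 0) Primrec.snd))
    (Primrec.list_append.comp
      (Primrec.list_map hV (Primrec.pair (Primrec.const 1) Primrec.snd))
      (Primrec.list_map (primrec_lettersBelow.comp hn) (Primrec.pair (Primrec.const 2)
        (Primrec.list_cons.comp Primrec.snd (Primrec.const [])))))

theorem primrecPred_edge {n : α → ℕ} {S : α → List (List (ℕ × Bool))} {a b : α → TaggedWord}
    {x : α → ℕ × Bool} (hn : Primrec n) (hS : Primrec S) (ha : Primrec a) (hx : Primrec x)
    (hb : Primrec b) : PrimrecPred fun i => Edge (n i) (S i) (a i) (x i) (b i) := by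
  have hQ := primrec_states hn hS
  have ha1 := Primrec.fst.comp ha
  have hb1 := Primrec.fst.comp hb
  have hx' : Primrec fun i => [x i] := Primrec.list_cons.comp hx (Primrec.const [])
  have hy' : Primrec fun i => [letterInv (x i)] :=
    Primrec.list_cons.comp (primrec_letterInv.comp hx) (Primrec.const [])
  have hw : Primrec fun i => (a i).2 ++ [x i] ++ invRev (b i).2 :=
    Primrec.list_append.comp (Primrec.list_append.comp (Primrec.snd.comp ha) hx')
      (primrec_invRev.comp (Primrec.snd.comp hb))
  refine (primrecPred_mem ha hQ).and ((primrecPred_mem hb hQ).and (PrimrecPred.or ?_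
    (PrimrecPred.or ?_ ?_)))
  · exact (Primrec.eq.comp ha1 hb1).and ((Primrec.nat_le.comp ha1 (Primrec.const 1)).and
      (primrecPred_mem_wordSubgroup hS hw))
  · exact (Primrec.eq.comp ha1 (Primrec.const 0)).and
      ((Primrec.eq.comp hb1 (Primrec.const 1)).and (primrecPred_generatesWith hn hS hw))
  · exact (Primrec.eq.comp ha1 (Primrec.const 2)).and
      ((Primrec.eq.comp hb1 (Primrec.const 2)).and
        ((Primrec.eq.comp (Primrec.snd.comp hb) hx').and
          (Primrec.eq.comp (Primrec.snd.comp ha) hy').not))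

theorem primrec_allPairs : Primrec (allPairs : List α → List (α × α)) :=
  Primrec.list_flatMap Primrec.id (Primrec.list_map Primrec.fst
    (Primrec.pair (Primrec.snd.comp Primrec.fst) Primrec.snd))

theorem primrec_relList {Q : α → List TaggedWord} {r : α → TaggedWord → TaggedWord → Prop}
    (hQ : Primrec Q) (hr : PrimrecRel fun i (ab : TaggedWord × TaggedWord) => r i ab.1 ab.2) :
    Primrec fun i => relList (Q i) (r i) := by
  classical
  exact primrec_filter (primrec_allPairs.comp hQ) hr

theorem primrec_compRel {Q : α → List TaggedWord} {m g : α → StateRel} (hQ : Primrec Q)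
    (hm : Primrec m) (hg : Primrec g) : Primrec fun i => compRel (Q i) (m i) (g i) := by
  refine primrec_relList hQ (primrecPred_bex (hQ.comp Primrec.fst) ?_)
  have h1 : Primrec fun q : (α × TaggedWord × TaggedWord) × TaggedWord => q.1.1 :=
    Primrec.fst.comp Primrec.fst
  have h2 : Primrec fun q : (α × TaggedWord × TaggedWord) × TaggedWord => q.1.2 :=
    Primrec.snd.comp Primrec.fst
  exact (primrecPred_mem ((Primrec.fst.comp h2).pair Primrec.snd) (hm.comp h1)).and
    (primrecPred_mem (Primrec.snd.pair (Primrec.snd.comp h2)) (hg.comp h1))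

theorem primrec_idRel {Q : α → List TaggedWord} (hQ : Primrec Q) :
    Primrec fun i => idRel (Q i) :=
  primrec_relList hQ (Primrec.eq.comp (Primrec.fst.comp Primrec.snd)
    (Primrec.snd.comp Primrec.snd))

theorem primrec_powRel {Q : α → List TaggedWord} {g : α → StateRel} {k : α → ℕ}
    (hQ : Primrec Q) (hg : Primrec g) (hk : Primrec k) :
    Primrec fun i => powRel (Q i) (g i) (k i) :=
  Primrec.nat_rec' (h := fun i q => compRel (Q i) q.2 (g i)) hk (primrec_idRel hQ)
    (primrec_compRel (hQ.comp Primrec.fst) (Primrec.snd.comp Primrec.snd) (hg.comp Primrec.fst))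

theorem primrec_allRels : Primrec allRels :=
  primrec_listsUpTo.comp primrec_allPairs (Primrec.list_length.comp primrec_allPairs)

theorem primrec_letterRel {n : α → ℕ} {S : α → List (List (ℕ × Bool))} {x : α → ℕ × Bool}
    (hn : Primrec n) (hS : Primrec S) (hx : Primrec x) :
    Primrec fun i => letterRel (n i) (S i) (x i) :=
  primrec_relList (primrec_states hn hS) (primrecPred_edge (hn.comp Primrec.fst)
    (hS.comp Primrec.fst) (Primrec.fst.comp Primrec.snd) (hx.comp Primrec.fst)
    (Primrec.snd.comp Primrec.snd))

theorem primrecPred_accepts {n : α → ℕ} {S : α → List (List (ℕ × Bool))}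
    {m₁ g m₂ : α → StateRel} (hn : Primrec n) (hS : Primrec S) (h₁ : Primrec m₁)
    (hg : Primrec g) (h₂ : Primrec m₂) :
    PrimrecPred fun i => Accepts (n i) (S i) (m₁ i) (g i) (m₂ i) := by
  have hQ := primrec_states hn hS
  have hu := primrec_compRel hQ (primrec_compRel hQ h₁ hg) h₂
  have hgg := primrec_compRel hQ hg hg
  have hp := primrec_compRel hQ h₁
    (primrec_powRel hQ hg (Primrec.list_length.comp (primrec_vertexWords.comp hS)))
  have htwo : PrimrecRel fun (_ : α) (r : TaggedWord × TaggedWord) => r.1.1 = 2 :=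
    Primrec.eq.comp (Primrec.fst.comp (Primrec.fst.comp Primrec.snd)) (Primrec.const 2)
  have hzero : PrimrecRel fun (_ : α) (r : TaggedWord × TaggedWord) =>
      r.1 = (0, []) ∧ r.2.1 = 0 :=
    (Primrec.eq.comp (Primrec.fst.comp Primrec.snd) (Primrec.const (0, []))).and
      (Primrec.eq.comp (Primrec.fst.comp (Primrec.snd.comp Primrec.snd)) (Primrec.const 0))
  exact (primrecPred_mem (Primrec.const ((0, []), (1, []))) hu).and
    ((primrecPred_bex hu htwo).and ((primrecPred_bex hgg htwo).and
      (primrecPred_bex hp hzero).not))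

theorem primrec_toProduction {T N : Type*} [Primcodable T] [Primcodable N] :
    Primrec (LinearRule.toProduction : LinearRule T N → ℕ × List (T ⊕ ℕ)) := by
  have hmap : Primrec (List.map Sum.inl : List T → List (T ⊕ ℕ)) :=
    Primrec.list_map Primrec.id (Primrec.sumInl.comp Primrec.snd)
  refine Primrec.pair (Primrec.encode.comp Primrec.fst) ?_
  refine (Primrec.option_casesOn (o := fun r : LinearRule T N => r.2) (f := fun _ => [])
    (g := fun _ q => q.1.map Sum.inl ++ Sum.inr (Encodable.encode q.2.1) :: q.2.2.map Sum.inl)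
    Primrec.snd (Primrec.const []) ?_).of_eq ?_
  · exact Primrec.list_append.comp (hmap.comp (Primrec.fst.comp Primrec.snd))
      (Primrec.list_cons.comp
        (Primrec.sumInr.comp (Primrec.encode.comp
          (Primrec.fst.comp (Primrec.snd.comp Primrec.snd))))
        (hmap.comp (Primrec.snd.comp (Primrec.snd.comp Primrec.snd))))
  · rintro ⟨A, _ | q⟩ <;> rfl

theorem primrec_some_step {T : Type*} [Primcodable T] {N : Type*} [Primcodable N]
    {x y : α → List T} {A B : α → N} (hA : Primrec A) (hx : Primrec x) (hB : Primrec B)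
    (hy : Primrec y) :
    Primrec fun i => ((A i, some (x i, B i, y i)) : LinearRule T N) :=
  hA.pair (Primrec.option_some.comp (hx.pair (hB.pair hy)))

theorem primrec_nonTerm {m₁ m₂ : α → StateRel} {g : α → Option StateRel} (h₁ : Primrec m₁)
    (h₂ : Primrec m₂) (hg : Primrec g) : Primrec fun i => (some (m₁ i, m₂ i, g i) : NonTerm) :=
  Primrec.option_some.comp (h₁.pair (h₂.pair hg))

variable {n : α → ℕ} {S : α → List (List (ℕ × Bool))}

theorem primrec_startRules (hn : Primrec n) (hS : Primrec S) :
    Primrec fun i => startRules (α := ℕ) (n i) (S i) := by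
  classical
  unfold startRules
  have hI := primrec_idRel (primrec_states hn hS)
  refine Primrec.list_cons.comp (primrec_some_step (Primrec.const none) (Primrec.const [])
    (primrec_nonTerm hI hI (Primrec.const none)) (Primrec.const [])) ?_
  exact Primrec.ite (primrecPred_generatesWith hn hS (Primrec.const []))
    (Primrec.const _) (Primrec.const _)

theorem primrec_outerRules (hn : Primrec n) (hS : Primrec S) :
    Primrec fun i => outerRules id (lettersBelow (n i)) (n i) (S i) := by
  unfold outerRules
  have hQ := primrec_states hn hS
  have hR := primrec_allRels.comp hQ
  refine Primrec.list_flatMap hR (Primrec.list_flatMap (hR.comp Primrec.fst) ?_)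
  have hi : Primrec fun q : (α × StateRel) × StateRel => q.1.1 := Primrec.fst.comp Primrec.fst
  have h₁ : Primrec fun q : (α × StateRel) × StateRel => q.1.2 := Primrec.snd.comp Primrec.fst
  have h₂ : Primrec fun q : (α × StateRel) × StateRel => q.2 := Primrec.snd
  refine Primrec.list_cons.comp ?_ (Primrec.list_map (primrec_lettersBelow.comp (hn.comp hi)) ?_)
  · exact primrec_some_step (primrec_nonTerm h₁ h₂ (Primrec.const none)) (Primrec.const [])
      (primrec_nonTerm h₁ h₂ (Primrec.option_some.comp (primrec_idRel (hQ.comp hi))))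
      (Primrec.const [])
  · have hi' := hi.comp (Primrec.fst (β := ℕ × Bool))
    have h₁' := h₁.comp (Primrec.fst (β := ℕ × Bool))
    have h₂' := h₂.comp (Primrec.fst (β := ℕ × Bool))
    have hx : Primrec fun q : ((α × StateRel) × StateRel) × ℕ × Bool => q.2 := Primrec.snd
    exact primrec_some_step (primrec_nonTerm h₁' h₂' (Primrec.const none))
      (Primrec.list_cons.comp hx (Primrec.const []))
      (primrec_nonTerm
        (primrec_compRel (hQ.comp hi') h₁'
          (primrec_letterRel (hn.comp hi') (hS.comp hi') hx))
        (primrec_compRel (hQ.comp hi')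
          (primrec_letterRel (hn.comp hi') (hS.comp hi') (primrec_letterInv.comp hx)) h₂')
        (Primrec.const none))
      (Primrec.list_cons.comp (primrec_letterInv.comp hx) (Primrec.const []))

theorem primrec_innerRules (hn : Primrec n) (hS : Primrec S) :
    Primrec fun i => innerRules id (lettersBelow (n i)) (n i) (S i) := by
  classical
  unfold innerRules
  have hQ := primrec_states hn hS
  have hR := primrec_allRels.comp hQ
  refine Primrec.list_flatMap hR (Primrec.list_flatMap (hR.comp Primrec.fst)
    (Primrec.list_flatMap (hR.comp (Primrec.fst.comp Primrec.fst)) ?_))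
  have hi : Primrec fun q : ((α × StateRel) × StateRel) × StateRel => q.1.1.1 :=
    Primrec.fst.comp (Primrec.fst.comp Primrec.fst)
  have h₁ : Primrec fun q : ((α × StateRel) × StateRel) × StateRel => q.1.1.2 :=
    Primrec.snd.comp (Primrec.fst.comp Primrec.fst)
  have h₂ : Primrec fun q : ((α × StateRel) × StateRel) × StateRel => q.1.2 :=
    Primrec.snd.comp Primrec.fst
  have hg : Primrec fun q : ((α × StateRel) × StateRel) × StateRel => q.2 := Primrec.snd
  have hA := primrec_nonTerm h₁ h₂ (Primrec.option_some.comp hg)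
  refine Primrec.list_append.comp ?_
    (Primrec.list_map (primrec_lettersBelow.comp (hn.comp hi)) ?_)
  · exact Primrec.ite (primrecPred_accepts (hn.comp hi) (hS.comp hi) h₁ hg h₂)
      (Primrec.list_cons.comp (hA.pair (Primrec.const none)) (Primrec.const []))
      (Primrec.const [])
  · have hi' := hi.comp (Primrec.fst (β := ℕ × Bool))
    have h₁' := h₁.comp (Primrec.fst (β := ℕ × Bool))
    have h₂' := h₂.comp (Primrec.fst (β := ℕ × Bool))
    have hg' := hg.comp (Primrec.fst (β := ℕ × Bool))
    have hx : Primrec fun q : (((α × StateRel) × StateRel) × StateRel) × ℕ × Bool => q.2 :=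
      Primrec.snd
    exact primrec_some_step (hA.comp Primrec.fst)
      (Primrec.list_cons.comp hx (Primrec.const []))
      (primrec_nonTerm h₁' h₂' (Primrec.option_some.comp (primrec_compRel (hQ.comp hi') hg'
        (primrec_letterRel (hn.comp hi') (hS.comp hi') hx))))
      (Primrec.const [])

theorem primrec_cocycleCode :
    Primrec fun i : ℕ × List (List (ℕ × Bool)) =>
      linearCode none (cocycleRules id (lettersBelow i.1) i.1 i.2) := by
  have hn : Primrec fun i : ℕ × List (List (ℕ × Bool)) => i.1 := Primrec.fst
  have hS : Primrec fun i : ℕ × List (List (ℕ × Bool)) => i.2 := Primrec.snd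
  exact (Primrec.const _).pair (Primrec.list_map
    (Primrec.list_append.comp (primrec_startRules hn hS)
      (Primrec.list_append.comp (primrec_outerRules hn hS) (primrec_innerRules hn hS)))
    (primrec_toProduction.comp Primrec.snd))

end Primrec

/-! ### Renaming terminals and transfer to the free group on `Fin n` -/

section Terminals

variable {T T' N : Type*} (φ : T → T')

/-- Renaming of the terminals in a linear rule. -/
def LinearRule.mapTerminals (r : LinearRule T N) : LinearRule T' N :=
  (r.1, r.2.map fun q => (q.1.map φ, q.2.1, q.2.2.map φ))

theorem mapTerminals_linearCode [Encodable N] (s : N) (R : List (LinearRule T N)) :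
    GrammarCode.mapTerminals φ (linearCode s R) =
      linearCode s (R.map (LinearRule.mapTerminals φ)) := by
  simp only [GrammarCode.mapTerminals, linearCode, List.map_map, Prod.mk.injEq, true_and]
  refine List.map_congr_left ?_
  rintro ⟨A, _ | ⟨x, B, y⟩⟩ -
  · rfl
  · simp [LinearRule.toProduction, LinearRule.mapTerminals, Function.comp_def]

end Terminals

/-- States, relations and acceptance see a letter only through its number, so renaming the terminals
leaves all nonterminals in place. This links the grammar over `Fin n` to the one computed uniformly
over `ℕ`. -/
theorem map_cocycleRules {α : Type*} (e : α → ℕ) (L : List (α × Bool)) (n : ℕ)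
    (S : List (List (ℕ × Bool))) :
    (cocycleRules e L n S).map (LinearRule.mapTerminals (mapLetter e)) =
      cocycleRules id (L.map (mapLetter e)) n S := by
  have h1 : (startRules n S).map (LinearRule.mapTerminals (mapLetter e)) = startRules n S := by
    unfold startRules
    split_ifs <;> rfl
  have h2 : (outerRules e L n S).map (LinearRule.mapTerminals (mapLetter e)) =
      outerRules id (L.map (mapLetter e)) n S := by
    simp only [outerRules, List.map_flatMap, List.map_cons, List.map_map]
    rfl
  have h3 : (innerRules e L n S).map (LinearRule.mapTerminals (mapLetter e)) =
      innerRules id (L.map (mapLetter e)) n S := by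
    simp only [innerRules, List.map_flatMap, List.map_append, List.map_map]
    congr! 7 with m₁ m₂ g
    split_ifs <;> rfl
  rw [cocycleRules, List.map_append, List.map_append, h1, h2, h3, cocycleRules]

/-- All letters over `n` generators. -/
def finLetters (n : ℕ) : List (Fin n × Bool) :=
  (List.finRange n).flatMap fun i => [(i, true), (i, false)]

theorem mem_finLetters {n : ℕ} (x : Fin n × Bool) : x ∈ finLetters n := by
  obtain ⟨i, s⟩ := x
  cases s <;> simp [finLetters]

theorem map_finLetters (n : ℕ) : (finLetters n).map (mapLetter Fin.val) = lettersBelow n := by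
  rw [finLetters, lettersBelow, ← List.map_coe_finRange_eq_range, List.map_flatMap,
    List.flatMap_map]
  rfl

/-- The grammar code of the direct cocycles of the subgroup generated by a list of words. -/
noncomputable def cocycleCode {n : ℕ} (S : List (List (Fin n × Bool))) :
    GrammarCode (Fin n × Bool) :=
  linearCode none (cocycleRules Fin.val (finLetters n) n (S.map (List.map letterCode)))

theorem mapTerminals_cocycleCode {n : ℕ} (S : List (List (Fin n × Bool))) :
    GrammarCode.mapTerminals letterCode (cocycleCode S) =
      linearCode none (cocycleRules id (lettersBelow n) n (S.map (List.map letterCode))) := by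
  rw [← map_finLetters, ← map_cocycleRules, ← mapTerminals_linearCode]
  rfl

section Transfer

variable {n : ℕ} {S : List (List (Fin n × Bool))} {w : List (Fin n × Bool)}

theorem mk_map_letterCode (w : List (Fin n × Bool)) :
    FreeGroup.mk (w.map letterCode) = FreeGroup.map Fin.val (FreeGroup.mk w) := rfl

/-- The inclusion of `Fin n` in `ℕ` induces an injective homomorphism of free groups, which maps one
subgroup onto the other. -/
theorem mk_map_mem_wordSubgroup :
    FreeGroup.mk (w.map letterCode) ∈ wordSubgroup (S.map (List.map letterCode)) ↔
      FreeGroup.mk w ∈ wordSubgroup S := by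
  have h : wordSubgroup (S.map (List.map letterCode)) =
      (wordSubgroup S).map (FreeGroup.map Fin.val) := by
    rw [MonoidHom.map_closure]
    refine congrArg Subgroup.closure ?_
    ext g
    simp only [List.mem_map, exists_exists_and_eq_and, Set.mem_ofPred_eq, Set.mem_image]
    rfl
  rw [h, mk_map_letterCode,
    Subgroup.mem_map_iff_mem (FreeGroup.map_injective Fin.val_injective)]

theorem wordSubgroup_cons (S : List (List (Fin n × Bool))) (w : List (Fin n × Bool)) :
    wordSubgroup (w :: S) = generatedSubgroup S ⊔ Subgroup.zpowers (FreeGroup.mk w) := by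
  rw [Subgroup.zpowers_eq_closure, generatedSubgroup, ← Subgroup.closure_union]
  refine congrArg Subgroup.closure ?_
  ext g
  simp only [List.mem_cons, exists_eq_or_imp, Set.mem_ofPred_eq, Set.mem_union,
    Set.mem_singleton_iff]
  rw [or_comm, eq_comm]

theorem generatesWith_iff :
    GeneratesWith n (S.map (List.map letterCode)) (w.map letterCode) ↔
      generatedSubgroup S ⊔ Subgroup.zpowers (FreeGroup.mk w) = ⊤ := by
  rw [← wordSubgroup_cons]
  have h : ∀ x : Fin n × Bool, FreeGroup.mk [letterCode x] ∈
      wordSubgroup (w.map letterCode :: S.map (List.map letterCode)) ↔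
        FreeGroup.mk [x] ∈ wordSubgroup (w :: S) := fun x => by
    rw [← List.map_cons, ← mk_map_mem_wordSubgroup]; rfl
  constructor
  · intro hg
    rw [eq_top_iff, ← FreeGroup.closure_range_of, Subgroup.closure_le]
    rintro _ ⟨i, rfl⟩
    exact (h (i, true)).1 (hg _ (by simp [letterCode]))
  · intro htop x hx
    have := (h (⟨x.1, by simpa using hx⟩, x.2)).2 (by rw [htop]; trivial)
    exact this

/-- Torsion-freeness gives `u = 1` from `u ^ k = 1`; negative exponents reduce to positive ones
because `H` is closed under inverses. -/
theorem inf_zpowers_eq_bot_iff {α : Type*} {H : Subgroup (FreeGroup α)} {u : FreeGroup α} :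
    H ⊓ Subgroup.zpowers u = ⊥ ↔ ∀ k : ℕ, k ≠ 0 → u ^ k ∈ H → u = 1 := by
  constructor
  · intro h k hk hmem
    have : u ^ k ∈ H ⊓ Subgroup.zpowers u := ⟨hmem, Subgroup.npow_mem_zpowers u k⟩
    rw [h, Subgroup.mem_bot] at this
    exact (pow_eq_one_iff_left hk).1 this
  · intro h
    rw [eq_bot_iff]
    rintro _ ⟨hg, z, rfl⟩
    rw [Subgroup.mem_bot]
    change u ^ z ∈ H at hg
    change u ^ z = 1
    by_cases hz : z = 0
    · simp [hz]
    · rw [h z.natAbs (by simpa using hz), one_zpow]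
      rcases Int.natAbs_eq z with h' | h'
      · rwa [h', zpow_natCast] at hg
      · rw [h', zpow_neg, zpow_natCast] at hg
        exact (Subgroup.inv_mem_iff _).1 hg

theorem language_cocycleCode (S : List (List (Fin n × Bool))) :
    (GrammarCode.toGrammar (cocycleCode S)).language =
      reducedForms (directCocycles (generatedSubgroup S)) := by
  ext w
  have hw : w ∈ reducedForms (directCocycles (generatedSubgroup S)) ↔
      FreeGroup.IsReduced w ∧ FreeGroup.mk w ∈ directCocycles (generatedSubgroup S) := by
    constructor
    · rintro ⟨u, hu, rfl⟩
      exact ⟨isReduced_toWord, by rwa [mk_toWord]⟩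
    · rintro ⟨hred, hu⟩
      exact ⟨_, hu, by rw [toWord_mk, hred.reduce_eq]⟩
  refine mem_language_linearCode.trans ?_
  rw [linearDerives_start_iff_of_lt mem_finLetters (fun i => i.is_lt) Fin.val_injective, hw]
  refine and_congr_right fun hred => and_congr generatesWith_iff ?_
  rw [inf_zpowers_eq_bot_iff]
  refine forall_congr' fun k => imp_congr_right fun _ => imp_congr ?_ ?_
  · rw [pow_mk, pow_mk, generatedSubgroup, ← mk_map_mem_wordSubgroup, List.map_flatten,
      List.map_replicate]
    rfl
  · rw [← toWord_eq_nil_iff, toWord_mk, hred.reduce_eq]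

end Transfer

theorem exists_generatedSubgroup_eq {n : ℕ} {H : Subgroup (FreeGroup (Fin n))} (hH : H.FG) :
    ∃ S : List (List (Fin n × Bool)), generatedSubgroup S = H := by
  obtain ⟨s, rfl⟩ := hH
  refine ⟨s.toList.map FreeGroup.toWord, ?_⟩
  rw [generatedSubgroup]
  refine congrArg Subgroup.closure ?_
  ext g
  simp [mk_toWord]

end DirectCocycles

theorem mainTheorem3 :
    (∀ (n : ℕ) (H : Subgroup (FreeGroup (Fin n))), H.FG →
      DirectCocycles.IsContextFreeSubset (DirectCocycles.directCocycles H)) ∧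
    (∃ f : ℕ × List (List (ℕ × Bool)) → DirectCocycles.GrammarCode (ℕ × Bool), Computable f ∧
      ∀ (n : ℕ) (S : List (List (Fin n × Bool))),
        ∃ c : DirectCocycles.GrammarCode (Fin n × Bool),
          f (n, S.map (List.map DirectCocycles.letterCode)) =
            DirectCocycles.GrammarCode.mapTerminals DirectCocycles.letterCode c ∧
          (DirectCocycles.GrammarCode.toGrammar c).language =
            DirectCocycles.reducedForms
              (DirectCocycles.directCocycles (DirectCocycles.generatedSubgroup S))) := by
  -- The algorithm is the grammar over `ℕ × Bool`, a single type for all `n`; `cocycleCode S` is the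
  -- grammar over `Fin n × Bool` whose renaming it outputs.
  refine ⟨fun n H hH => ?_, _, DirectCocycles.primrec_cocycleCode.to_comp, fun n S =>
    ⟨DirectCocycles.cocycleCode S, (DirectCocycles.mapTerminals_cocycleCode S).symm,
      DirectCocycles.language_cocycleCode S⟩⟩
  obtain ⟨S, rfl⟩ := DirectCocycles.exists_generatedSubgroup_eq hH
  exact ⟨_, DirectCocycles.language_cocycleCode S⟩
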